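/- Let $M\subseteq\mathbb{R}^n$ be an $n$-dimensional manifold, that is, an open set, and let $V=[V_1,\dots,V_m]$ be a smooth $n\times m$ field on $M$, with columns the vector fields $V_1,\dots,V_m$. Suppose that $V$ generates a smooth $m$-parameter flow $\phi:\mathbb{R}^m\times M\to M$, $(C,s)\mapsto\phi^{C}(s)$, that is, $\phi$ is smooth and, for all $s\in M$, $B,C\in\mathbb{R}^m$ and $c=1,\dots,m$, $$\phi^{0}(s)=s,\qquad \phi^{B}(\phi^{C}(s))=\phi^{B+C}(s),\qquad \frac{\partial \phi^{C}(s)}{\partial C_c}=V_c(\phi^{C}(s)).$$ Let $\Omega\subset M$ be an oriented compact smooth embedded $r$-dimensional submanifold with (possibly empty) boundary, where $r\ge 0$, and let $\Omega(C)=\phi^{C}(\Omega)$ with the transported orientation; $\partial\Omega(C)$ carries the induced orientation (outward normal first). Fix $C\in\mathbb{R}^m$ and let $\omega$ be an $r$-form on $M$ (not depending explicitly on $C$) that is $C^1$ in a neighbourhood of each point of $\Omega(C)$. Let $e_1,\dots,e_m$ be the standard basis of $\mathbb{R}^m$, and let $\mathcal{L}_V^{(C)}\omega=[\mathcal{L}_{V_1}\omega,\dots,\mathcal{L}_{V_m}\omega]^\top$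 with $$\mathcal{L}_{V_c}\omega=\lim_{h\to 0}\frac{(\phi^{h e_c})^*\omega-\omega}{h},$$ and let $i_V^{(C)}\omega=[i_{V_1}\omega,\dots,i_{V_m}\omega]^\top$ be the vector of interior products (which vanish if $r=0$). Then at every point of $\Omega(C)$ these limits exist and $$\mathcal{L}_V^{(C)}\omega=i_V^{(C)}\,d\omega+d\,(i_V^{(C)}\omega),$$ and the function $B\mapsto\int_{\Omega(B)}\omega$ on $\mathbb{R}^m$ is differentiable at $C$, with total differential $$d\int_{\Omega(C)}\omega=\Bigl[\int_{\Omega(C)}\mathcal{L}_V^{(C)}\omega\Bigr]\cdot dC=\Bigl[\int_{\Omega(C)}i_V^{(C)}\,d\omega+\oint_{\partial\Omega(C)}i_V^{(C)}\omega\Bigr]\cdot dC=\Bigl[\int_{\Omega(C)}\bigl(i_V^{(C)}\,d\omega+d\,(i_V^{(C)}\omega)\bigr)\Bigr]\cdot dC .$$ -/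

import Mathlib

open Set MeasureTheory


noncomputable section

/-! Smooth calculus on `ℝⁿ`, written `Fin n → ℝ`; only its smooth structure is used, never a norm. -/

/-- (Not necessarily continuous) differential `r`-forms on `ℝⁿ`. -/
abbrev DiffForm (n r : ℕ) : Type := (Fin n → ℝ) → (Fin n → ℝ) [⋀^Fin r]→L[ℝ] ℝ

/-- The pullback `f^* ω` of a form by a map `f`. -/
def pullbackForm {n r : ℕ} (f : (Fin n → ℝ) → (Fin n → ℝ)) (ω : DiffForm n r) : DiffForm n r :=
  fun x => (ω (f x)).compContinuousLinearMap (fderiv ℝ f x)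

/-- The interior product `i_X ω`, of degree `r - 1`; it is `0` on forms of degree `0`. -/
def interiorProduct {n : ℕ} :
    {r : ℕ} → ((Fin n → ℝ) → (Fin n → ℝ)) → DiffForm n r → DiffForm n (r - 1)
  | 0, _, _ => 0
  | _ + 1, X, ω => fun x => (ω x).curryLeft (X x)

/-- The form `i_X dω`, of the same degree as `ω`. -/
def interiorProductExtDeriv {n r : ℕ} (X : (Fin n → ℝ) → (Fin n → ℝ)) (ω : DiffForm n r) :
    DiffForm n r :=
  interiorProduct (r := r + 1) X (extDeriv ω)

/-- The exterior derivative `d (i_X ω)`; it is `0` if `ω` has degree `0`. -/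
def extDerivInteriorProduct {n : ℕ} :
    {r : ℕ} → ((Fin n → ℝ) → (Fin n → ℝ)) → DiffForm n r → DiffForm n r
  | 0, _, _ => 0
  | r + 1, X, ω =>
      let η : DiffForm n r := interiorProduct X ω
      extDeriv η

/-! ### Oriented compact submanifolds with boundary -/

/-- The closed half-space `x₀ ≥ 0` of `ℝʳ`; all of `ℝ⁰` if `r = 0`. -/
def halfSpace (r : ℕ) : Set (Fin r → ℝ) := {u | ∀ h : 0 < r, 0 ≤ u ⟨0, h⟩}

/-- A local parametrization by a relatively open piece `dom ∩ {x₀ ≥ 0}` of the half-space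
(for an interior piece, `dom` avoids `x₀ = 0`), with a sign that tells whether it preserves or
reverses orientation. The map is smooth on the open set `dom`, that is, across the boundary.
Signs are needed to orient points (`r = 0`) and the two ends of an interval (`r = 1`). -/
structure SignedPatch (n r : ℕ) where
  dom : Set (Fin r → ℝ)
  isOpen_dom : IsOpen dom
  param : (Fin r → ℝ) → (Fin n → ℝ)
  smooth : ContDiffOn ℝ (⊤ : ℕ∞) param dom
  injOn : InjOn param (dom ∩ halfSpace r)
  immersion : ∀ u ∈ dom ∩ halfSpace r, Function.Injective (fderiv ℝ param u)
  sign : ℤˣ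

/-- An oriented compact smooth embedded `r`-dimensional submanifold with (possibly empty) boundary
of `ℝⁿ`, given by an oriented atlas. -/
structure OrientedCompactSubmanifold (n r : ℕ) where
  carrier : Set (Fin n → ℝ)
  isCompact : IsCompact carrier
  charts : Set (SignedPatch n r)
  /-- Each chart is a homeomorphism onto a relatively open subset of the submanifold. -/
  chart_open : ∀ p ∈ charts, ∀ U : Set (Fin r → ℝ), IsOpen U → U ⊆ p.dom →
    ∃ W : Set (Fin n → ℝ), IsOpen W ∧ p.param '' (U ∩ halfSpace r) = carrier ∩ W
  cover : ∀ x ∈ carrier, ∃ p ∈ charts, x ∈ p.param '' (p.dom ∩ halfSpace r)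
  /-- Any two charts induce the same orientation of the tangent spaces where they overlap. -/
  oriented : ∀ p ∈ charts, ∀ q ∈ charts, ∀ u ∈ p.dom ∩ halfSpace r, ∀ v ∈ q.dom ∩ halfSpace r,
    p.param u = q.param v →
      ∃ A : (Fin r → ℝ) →L[ℝ] (Fin r → ℝ), fderiv ℝ p.param u = (fderiv ℝ q.param v).comp A ∧
        0 < (((p.sign * q.sign : ℤˣ) : ℤ) : ℝ) * A.det

/-- A finite smooth partition of unity on `Ω`, subordinate to charts of `Ω`. -/
structure ChartPartition {n r : ℕ} (Ω : OrientedCompactSubmanifold n r) where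
  size : ℕ
  chart : Fin size → SignedPatch n r
  chart_mem : ∀ i, chart i ∈ Ω.charts
  weight : Fin size → (Fin n → ℝ) → ℝ
  smooth : ∀ i, ContDiff ℝ (⊤ : ℕ∞) (weight i)
  nonneg : ∀ i x, 0 ≤ weight i x
  support : ∀ i, Ω.carrier ∩ tsupport (weight i) ⊆
    (chart i).param '' ((chart i).dom ∩ halfSpace r)
  sum_eq_one : ∀ x ∈ Ω.carrier, ∑ i, weight i x = 1

theorem ChartPartition.exists_partition {n r : ℕ} (Ω : OrientedCompactSubmanifold n r) :
    Nonempty (ChartPartition Ω) := by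
  classical
  have h1 : ∀ x : Ω.carrier, ∃ p : SignedPatch n r, ∃ W : Set (Fin n → ℝ), p ∈ Ω.charts ∧
      IsOpen W ∧ (x : Fin n → ℝ) ∈ W ∧ p.param '' (p.dom ∩ halfSpace r) = Ω.carrier ∩ W := by
    intro x
    obtain ⟨p, hp, hx⟩ := Ω.cover x x.2
    obtain ⟨W, hW, hE⟩ := Ω.chart_open p hp p.dom p.isOpen_dom le_rfl
    exact ⟨p, W, hp, hW, (hE ▸ hx).2, hE⟩
  choose p W hp hW hxW hE using h1
  obtain ⟨t, ht⟩ := Ω.isCompact.elim_finite_subcover W hW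
    (fun x hx => mem_iUnion.2 ⟨⟨x, hx⟩, hxW ⟨x, hx⟩⟩)
  let e := t.equivFin
  obtain ⟨f, hf⟩ := SmoothPartitionOfUnity.exists_isSubordinate (modelWithCornersSelf ℝ (Fin n → ℝ))
    (s := Ω.carrier) Ω.isCompact.isClosed (fun i : Fin t.card => W (e.symm i))
    (fun i => hW _) (by
      intro x hx
      obtain ⟨y, hy, hxy⟩ := mem_iUnion₂.1 (ht hx)
      exact mem_iUnion.2 ⟨e ⟨y, hy⟩, by simpa using hxy⟩)
  refine ⟨⟨t.card, fun i => p (e.symm i), fun i => hp _, fun i => f i,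
    fun i => (f i).contMDiff.contDiff, fun i x => f.nonneg i x, fun i x hx => ?_, fun x hx => ?_⟩⟩
  · rw [hE]
    exact ⟨hx.1, hf i hx.2⟩
  · rw [← finsum_eq_sum_of_fintype]
    exact f.sum_eq_one hx

/-- The partition of unity through which integrals are computed; the integral of a continuous form
does not depend on it. -/
def OrientedCompactSubmanifold.partition {n r : ℕ} (Ω : OrientedCompactSubmanifold n r) :
    ChartPartition Ω :=
  Classical.choice (ChartPartition.exists_partition Ω)

/-- `∫_D ψ^* (ρ η)` for a map `ψ` from a piece `D` of `ℝᵏ` to `ℝⁿ`, a function `ρ` and a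
`k`-form `η`. -/
def patchIntegral {n k : ℕ} (D : Set (Fin k → ℝ)) (ψ : (Fin k → ℝ) → (Fin n → ℝ))
    (ρ : (Fin n → ℝ) → ℝ) (η : DiffForm n k) : ℝ :=
  ∫ u in D, ρ (ψ u) * η (ψ u) (fun j => fderiv ℝ ψ u (Pi.single j 1))

/-- The integral `∫_Ω ω` of an `r`-form over an oriented compact `r`-dimensional submanifold. -/
def OrientedCompactSubmanifold.integral {n r : ℕ} (Ω : OrientedCompactSubmanifold n r)
    (ω : DiffForm n r) : ℝ :=
  ∑ i, (((Ω.partition.chart i).sign : ℤ) : ℝ) *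
    patchIntegral ((Ω.partition.chart i).dom ∩ halfSpace r) (Ω.partition.chart i).param
      (Ω.partition.weight i) ω

/-- The integral `∮_{∂Ω} η` of an `(r-1)`-form over the boundary. The face `x₀ = 0` of a chart
parametrizes `∂Ω`; as `-∂/∂x₀` points outwards, the induced orientation (outward vector first)
multiplies its sign by `-1`. If `r = 0` the boundary is empty. -/
def OrientedCompactSubmanifold.boundaryIntegral {n : ℕ} :
    {r : ℕ} → OrientedCompactSubmanifold n r → DiffForm n (r - 1) → ℝ
  | 0, _, _ => 0
  | r + 1, Ω, η =>
      ∑ i, -(((Ω.partition.chart i).sign : ℤ) : ℝ) *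
        patchIntegral (n := n) (k := r)
          {v : Fin r → ℝ | (Fin.cons 0 v : Fin (r + 1) → ℝ) ∈ (Ω.partition.chart i).dom}
          (fun v => (Ω.partition.chart i).param (Fin.cons 0 v))
          (Ω.partition.weight i) η

/-! ### Multiparameter flows -/

/-- `φ` is the smooth `m`-parameter flow on `M` generated by the field `V`, whose `c`-th column
`V c` is the vector field that belongs to the parameter `C_c`. -/
structure IsFlow {n m : ℕ} (M : Set (Fin n → ℝ)) (V : Fin m → (Fin n → ℝ) → (Fin n → ℝ))
    (φ : (Fin m → ℝ) → (Fin n → ℝ) → (Fin n → ℝ)) : Prop where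
  mapsTo : ∀ C, MapsTo (φ C) M M
  smooth : ContDiffOn ℝ (⊤ : ℕ∞) (fun z : (Fin m → ℝ) × (Fin n → ℝ) => φ z.1 z.2) (univ ×ˢ M)
  /-- `∂φ/∂C_c = V_c` along the flow. -/
  hasLineDerivAt : ∀ C, ∀ s ∈ M, ∀ c : Fin m,
    HasLineDerivAt ℝ (fun B => φ B s) (V c (φ C s)) C (Pi.single c 1)
  map_zero : ∀ s ∈ M, φ 0 s = s
  map_add : ∀ s ∈ M, ∀ B C, φ B (φ C s) = φ (B + C) s

namespace IsFlow

variable {n m : ℕ} {M : Set (Fin n → ℝ)} {V : Fin m → (Fin n → ℝ) → (Fin n → ℝ)}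
  {φ : (Fin m → ℝ) → (Fin n → ℝ) → (Fin n → ℝ)}

theorem contDiffOn (hφ : IsFlow M V φ) (C : Fin m → ℝ) : ContDiffOn ℝ (⊤ : ℕ∞) (φ C) M :=
  hφ.smooth.comp (f := fun s : Fin n → ℝ => (C, s)) (by fun_prop) (fun _ hs => ⟨mem_univ _, hs⟩)

theorem left_inv (hφ : IsFlow M V φ) (C : Fin m → ℝ) {s : Fin n → ℝ} (hs : s ∈ M) :
    φ (-C) (φ C s) = s := by
  rw [hφ.map_add s hs, neg_add_cancel, hφ.map_zero s hs]

theorem right_inv (hφ : IsFlow M V φ) (C : Fin m → ℝ) {s : Fin n → ℝ} (hs : s ∈ M) :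
    φ C (φ (-C) s) = s := by
  rw [hφ.map_add s hs, add_neg_cancel, hφ.map_zero s hs]

theorem differentiableAt (hφ : IsFlow M V φ) (hM : IsOpen M) (C : Fin m → ℝ) {s : Fin n → ℝ}
    (hs : s ∈ M) : DifferentiableAt ℝ (φ C) s :=
  ((hφ.contDiffOn C).contDiffAt (hM.mem_nhds hs)).differentiableAt (by simp)

theorem fderiv_injective (hφ : IsFlow M V φ) (hM : IsOpen M) (C : Fin m → ℝ) {s : Fin n → ℝ}
    (hs : s ∈ M) : Function.Injective (fderiv ℝ (φ C) s) := by
  have h1 := (hφ.differentiableAt hM (-C) (hφ.mapsTo C hs)).hasFDerivAt.comp s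
    (hφ.differentiableAt hM C hs).hasFDerivAt
  have h2 : HasFDerivAt (φ (-C) ∘ φ C) (ContinuousLinearMap.id ℝ (Fin n → ℝ)) s := by
    refine (hasFDerivAt_id s).congr_of_eventuallyEq ?_
    filter_upwards [hM.mem_nhds hs] with y hy using hφ.left_inv C hy
  have h3 := h1.unique h2
  refine Function.LeftInverse.injective (g := fderiv ℝ (φ (-C)) (φ C s)) fun v => ?_
  simpa using congrArg (fun L => L v) h3

/-- The local parametrization `φ^C ∘ ψ`, with the part of its domain on which it makes sense. -/
def movePatch (hφ : IsFlow M V φ) (hM : IsOpen M) (C : Fin m → ℝ) {r : ℕ}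
    (p : SignedPatch n r) : SignedPatch n r where
  dom := p.dom ∩ p.param ⁻¹' M
  isOpen_dom := p.smooth.continuousOn.isOpen_inter_preimage p.isOpen_dom hM
  param := φ C ∘ p.param
  smooth := (hφ.contDiffOn C).comp (p.smooth.mono inter_subset_left) fun _ hu => hu.2
  injOn := by
    intro u hu v hv huv
    refine p.injOn ⟨hu.1.1, hu.2⟩ ⟨hv.1.1, hv.2⟩ ?_
    rw [← hφ.left_inv C hu.1.2, ← hφ.left_inv C hv.1.2]
    exact congrArg _ huv
  immersion := by
    intro u hu
    have h1 : DifferentiableAt ℝ p.param u :=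
      (p.smooth.contDiffAt (p.isOpen_dom.mem_nhds hu.1.1)).differentiableAt (by simp)
    rw [fderiv_comp u (hφ.differentiableAt hM C hu.1.2) h1]
    exact (hφ.fderiv_injective hM C hu.1.2).comp (p.immersion u ⟨hu.1.1, hu.2⟩)
  sign := p.sign

/-- The transported submanifold `Ω(C) = φ^C Ω`, with the transported orientation. -/
def move (hφ : IsFlow M V φ) (hM : IsOpen M) {r : ℕ} (Ω : OrientedCompactSubmanifold n r)
    (hΩ : Ω.carrier ⊆ M) (C : Fin m → ℝ) : OrientedCompactSubmanifold n r where
  carrier := φ C '' Ω.carrier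
  isCompact := Ω.isCompact.image_of_continuousOn ((hφ.contDiffOn C).continuousOn.mono hΩ)
  charts := hφ.movePatch hM C '' Ω.charts
  chart_open := by
    rintro _ ⟨p, hp, rfl⟩ U hU hUd
    obtain ⟨W, hW, hE⟩ := Ω.chart_open p hp U hU (hUd.trans inter_subset_left)
    refine ⟨M ∩ φ (-C) ⁻¹' W,
      (hφ.contDiffOn (-C)).continuousOn.isOpen_inter_preimage hM hW, ?_⟩
    change (φ C ∘ p.param) '' (U ∩ halfSpace r) = _
    rw [image_comp, hE]
    ext y
    constructor
    · rintro ⟨x, ⟨hx, hxW⟩, rfl⟩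
      exact ⟨⟨x, hx, rfl⟩, hφ.mapsTo C (hΩ hx), by
        rw [mem_preimage, hφ.left_inv C (hΩ hx)]; exact hxW⟩
    · rintro ⟨⟨x, hx, rfl⟩, -, hxW⟩
      rw [mem_preimage, hφ.left_inv C (hΩ hx)] at hxW
      exact ⟨x, ⟨hx, hxW⟩, rfl⟩
  cover := by
    rintro _ ⟨x, hx, rfl⟩
    obtain ⟨p, hp, u, hu, rfl⟩ := Ω.cover x hx
    exact ⟨_, ⟨p, hp, rfl⟩, u, ⟨⟨hu.1, hΩ hx⟩, hu.2⟩, rfl⟩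
  oriented := by
    rintro _ ⟨p, hp, rfl⟩ _ ⟨q, hq, rfl⟩ u hu v hv huv
    have hpq : p.param u = q.param v := by
      rw [← hφ.left_inv C hu.1.2, ← hφ.left_inv C hv.1.2]
      exact congrArg _ huv
    obtain ⟨A, hA, hdet⟩ :=
      Ω.oriented p hp q hq u ⟨hu.1.1, hu.2⟩ v ⟨hv.1.1, hv.2⟩ hpq
    refine ⟨A, ?_, hdet⟩
    have h1 : DifferentiableAt ℝ p.param u :=
      (p.smooth.contDiffAt (p.isOpen_dom.mem_nhds hu.1.1)).differentiableAt (by simp)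
    have h2 : DifferentiableAt ℝ q.param v :=
      (q.smooth.contDiffAt (q.isOpen_dom.mem_nhds hv.1.1)).differentiableAt (by simp)
    change fderiv ℝ (φ C ∘ p.param) u = (fderiv ℝ (φ C ∘ q.param) v).comp A
    rw [fderiv_comp u (hφ.differentiableAt hM C hu.1.2) h1,
      fderiv_comp v (hφ.differentiableAt hM C hv.1.2) h2, hA, hpq,
      ContinuousLinearMap.comp_assoc]

end IsFlow

/-- The `c`-th component of the multiparameter Lie derivative, the derivative at `h = 0` of
`(φ^{h e_c})^* ω`. -/
def lieDerivative {n m r : ℕ} (φ : (Fin m → ℝ) → (Fin n → ℝ) → (Fin n → ℝ)) (c : Fin m)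
    (ω : DiffForm n r) : DiffForm n r :=
  fun x => deriv (fun h : ℝ => pullbackForm (φ (h • (Pi.single c 1 : Fin m → ℝ))) ω x) 0

/-- The linear form `dC ↦ a · dC` on the parameter space. -/
def dotDC {m : ℕ} (a : Fin m → ℝ) : (Fin m → ℝ) →L[ℝ] ℝ :=
  ∑ c, a c • ContinuousLinearMap.proj (R := ℝ) (φ := fun _ : Fin m => ℝ) c

end

/-!
By the group law, `Ω(B) = φ^{B - C} Ω(C)`, so a change of variables turns `∫_{Ω(B)} ω` into
`∫_{Ω(C)} (φ^{B - C})^* ω` (`IsFlow.integral_move`). The domain of integration no longer depends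
on `B`, and in charts the integrand is jointly of class `C¹` in `B` and the point, with compact
support (`IsFlow.contDiffAt_density`). Differentiation under the integral sign then gives the
derivative at `B = C`, whose components are the integrals of the Lie derivatives
(`IsFlow.hasFDerivAt_integral_move`).

The integral over `Ω(B)` is defined by a partition of unity that is chosen for every `B` separately,
hence the change of variables needs that integrals do not depend on the partition. This rests
on `OrientedCompactSubmanifold.integral_patch_eq_of_overlap`: a form that lives on the overlap of
two charts has the same integral in both. It follows from the change of variables formula, since
transition maps are differentiable along the half-space and the sign of their determinant is that
of the two orientations. Consequently an integral can be computed in a single chart whenever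
the form lives there (`OrientedCompactSubmanifold.integral_eq_integral_patch`).

Cartan's formula is a pointwise computation. The derivative of `φ^{h e_c}` in `h` is `V_c`, and by
the symmetry of second derivatives that of its spatial differential is the differential of `V_c`
(`IsFlow.hasDerivAt_fderiv`). The derivative of the pullback is therefore a sum of terms that
also appear when `i_V dω + d i_V ω` is expanded, where all other terms cancel (`cartan_apply`).

The boundary term comes from Stokes' theorem (`OrientedCompactSubmanifold.integral_extDeriv`). For
a form localized in a chart it reduces to the divergence theorem in a box one face of which lies
on the boundary of the half-space. The localized identities add up to the global one, because the
sum of the weights is constant along `Ω` and its differential vanishes on tangent vectors.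
-/

/-! ### Alternating maps -/

theorem contDiff_continuousAlternatingMap_apply {E : Type*} [NormedAddCommGroup E]
    [NormedSpace ℝ E] {ι : Type*} [Fintype ι] {k : WithTop ℕ∞} :
    ContDiff ℝ k (fun z : (E [⋀^ι]→L[ℝ] ℝ) × (ι → E) => z.1 z.2) := by
  rw [contDiff_iff_contDiffAt]
  intro z
  exact (ContinuousLinearMap.cpolynomialAt_uncurry_of_multilinear
    (ContinuousAlternatingMap.toContinuousMultilinearMapCLM (𝕜 := ℝ) (E := E) (F := ℝ) (ι := ι) ℝ)
    (x := z)).contDiffAt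

/-- A form of top degree on `ℝʳ` gets multiplied by `det A` under pullback by `A`; here the form is
the pullback of `T` by `L`. -/
theorem ContinuousAlternatingMap.map_comp_single {E : Type*} [NormedAddCommGroup E]
    [NormedSpace ℝ E] {r : ℕ} (T : E [⋀^Fin r]→L[ℝ] ℝ) (L : (Fin r → ℝ) →L[ℝ] E)
    (A : (Fin r → ℝ) →L[ℝ] (Fin r → ℝ)) :
    T (fun j => L (A (Pi.single j 1))) = A.det * T (fun j => L (Pi.single j 1)) := by
  have h := (T.toAlternatingMap.compLinearMap L.toLinearMap).eq_smul_basis_det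
    (Pi.basisFun ℝ (Fin r))
  have h1 := congrArg (fun f => f (A.toLinearMap ∘ Pi.basisFun ℝ (Fin r))) h
  simp only [AlternatingMap.smul_apply, Module.Basis.det_comp, Module.Basis.det_self] at h1
  simpa [Function.comp_def, ContinuousLinearMap.det, mul_comm] using h1

/-! ### Charts of compact submanifolds -/

theorem isClosed_halfSpace (r : ℕ) : IsClosed (halfSpace r) := by
  have : halfSpace r = ⋂ h : 0 < r, {u : Fin r → ℝ | 0 ≤ u ⟨0, h⟩} := by
    ext u; simp [halfSpace]
  rw [this]
  exact isClosed_iInter fun h => isClosed_le continuous_const (continuous_apply _)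

namespace SignedPatch

variable {n r : ℕ} (p : SignedPatch n r)

/-- The relatively open piece of the half-space that the patch parametrizes. -/
abbrev source : Set (Fin r → ℝ) := p.dom ∩ halfSpace r

/-- The part of the submanifold that the patch parametrizes. -/
abbrev target : Set (Fin n → ℝ) := p.param '' p.source

/-- The inverse of the parametrization, a function on `p.target`. -/
noncomputable def inv : (Fin n → ℝ) → (Fin r → ℝ) := Function.invFunOn p.param p.source

theorem inv_param {u : Fin r → ℝ} (hu : u ∈ p.source) : p.inv (p.param u) = u :=
  p.injOn.leftInvOn_invFunOn hu

theorem contDiffAt {u : Fin r → ℝ} (hu : u ∈ p.dom) : ContDiffAt ℝ (⊤ : ℕ∞) p.param u :=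
  p.smooth.contDiffAt (p.isOpen_dom.mem_nhds hu)

theorem differentiableAt {u : Fin r → ℝ} (hu : u ∈ p.dom) : DifferentiableAt ℝ p.param u :=
  (p.contDiffAt hu).differentiableAt (by simp)

theorem measurableSet_source : MeasurableSet p.source :=
  p.isOpen_dom.measurableSet.inter (isClosed_halfSpace r).measurableSet

theorem measurableSet_source_inter_preimage {W : Set (Fin n → ℝ)} (hW : IsOpen W) :
    MeasurableSet (p.source ∩ p.param ⁻¹' W) := by
  have : p.source ∩ p.param ⁻¹' W = (p.dom ∩ p.param ⁻¹' W) ∩ halfSpace r := by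
    ext; simp only [source, mem_inter_iff]; tauto
  rw [this]
  exact (p.smooth.continuousOn.isOpen_inter_preimage p.isOpen_dom hW).measurableSet.inter
    (isClosed_halfSpace r).measurableSet

/-- The coefficient of the pullback `ψ^* η` of an `r`-form by the parametrization `ψ`, with respect
to `du₁ ∧ … ∧ duᵣ`. -/
noncomputable def density (η : DiffForm n r) (u : Fin r → ℝ) : ℝ :=
  η (p.param u) fun j => fderiv ℝ p.param u (Pi.single j 1)

/-- The oriented integral of an `r`-form over a single patch. -/
noncomputable def integral (η : DiffForm n r) : ℝ :=
  ((p.sign : ℤ) : ℝ) * ∫ u in p.source, p.density η u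

theorem density_smul (ρ : (Fin n → ℝ) → ℝ) (η : DiffForm n r) (u : Fin r → ℝ) :
    p.density (fun x => ρ x • η x) u = ρ (p.param u) * p.density η u := rfl

end SignedPatch

namespace OrientedCompactSubmanifold

variable {n r : ℕ} {Ω : OrientedCompactSubmanifold n r} {p q : SignedPatch n r}

theorem exists_isOpen_target (hp : p ∈ Ω.charts) :
    ∃ W : Set (Fin n → ℝ), IsOpen W ∧ p.target = Ω.carrier ∩ W :=
  Ω.chart_open p hp p.dom p.isOpen_dom le_rfl

theorem target_subset (hp : p ∈ Ω.charts) : p.target ⊆ Ω.carrier := by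
  obtain ⟨W, -, hW⟩ := exists_isOpen_target hp
  exact hW ▸ inter_subset_left

theorem param_mem (hp : p ∈ Ω.charts) {u : Fin r → ℝ} (hu : u ∈ p.source) :
    p.param u ∈ Ω.carrier :=
  target_subset hp (mem_image_of_mem _ hu)

/-- Charts are homeomorphisms onto relatively open sets. -/
theorem continuousOn_inv (hp : p ∈ Ω.charts) : ContinuousOn p.inv p.target := by
  rw [continuousOn_iff]
  rintro _ ⟨u, hu, rfl⟩ t ht hut
  rw [p.inv_param hu] at hut
  obtain ⟨W, hW, hE⟩ := Ω.chart_open p hp (t ∩ p.dom) (ht.inter p.isOpen_dom) inter_subset_right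
  have hmem : p.param u ∈ Ω.carrier ∩ W := hE ▸ mem_image_of_mem _ ⟨⟨hut, hu.1⟩, hu.2⟩
  refine ⟨W, hW, hmem.2, ?_⟩
  rintro _ ⟨hxW, v, hv, rfl⟩
  have : p.param v ∈ p.param '' (t ∩ p.dom ∩ halfSpace r) := hE ▸ ⟨param_mem hp hv, hxW⟩
  obtain ⟨w, hw, hwv⟩ := this
  have : w = v := p.injOn ⟨hw.1.2, hw.2⟩ hv hwv
  rw [mem_preimage, p.inv_param hv, ← this]
  exact hw.1.1

theorem isCompact_source_inter_preimage (hp : p ∈ Ω.charts) {K : Set (Fin n → ℝ)}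
    (hK : IsCompact K) (hKp : K ⊆ p.target) : IsCompact (p.source ∩ p.param ⁻¹' K) := by
  have : p.source ∩ p.param ⁻¹' K = p.inv '' K := by
    ext u
    constructor
    · rintro ⟨hu, huK⟩
      exact ⟨_, huK, p.inv_param hu⟩
    · rintro ⟨x, hx, rfl⟩
      obtain ⟨u, hu, rfl⟩ := hKp hx
      rw [p.inv_param hu]
      exact ⟨hu, hx⟩
  rw [this]
  exact hK.image_of_continuousOn ((continuousOn_inv hp).mono hKp)

theorem continuousOn_fderiv_param (p : SignedPatch n r) :
    ContinuousOn (fderiv ℝ p.param) p.dom :=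
  p.smooth.continuousOn_fderiv_of_isOpen p.isOpen_dom (by simp)

theorem continuousOn_density (hp : p ∈ Ω.charts) {η : DiffForm n r}
    (hη : ContinuousOn η Ω.carrier) : ContinuousOn (p.density η) p.source := by
  have h1 : ContinuousOn (fun u => η (p.param u)) p.source :=
    hη.comp (p.smooth.continuousOn.mono inter_subset_left) fun u hu => param_mem hp hu
  have h2 : ContinuousOn (fun u => fun j : Fin r => fderiv ℝ p.param u (Pi.single j 1))
      p.source :=
    continuousOn_pi.2 fun j =>
      ((continuousOn_fderiv_param p).mono inter_subset_left).clm_apply continuousOn_const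
  exact (contDiff_continuousAlternatingMap_apply (k := 0)).continuous.comp_continuousOn
    (h1.prodMk h2)

theorem integrableOn_density (hp : p ∈ Ω.charts) {η : DiffForm n r}
    (hη : ContinuousOn η Ω.carrier) {K : Set (Fin n → ℝ)} (hK : IsCompact K) (hKp : K ⊆ p.target)
    (h0 : ∀ x ∈ Ω.carrier, x ∉ K → η x = 0) : IntegrableOn (p.density η) p.source := by
  have h1 : IntegrableOn (p.density η) (p.source ∩ p.param ⁻¹' K) :=
    ((continuousOn_density hp hη).mono inter_subset_left).integrableOn_compact
      (isCompact_source_inter_preimage hp hK hKp)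
  refine h1.of_forall_sdiff_eq_zero p.measurableSet_source fun u hu => ?_
  have : η (p.param u) = 0 := h0 _ (param_mem hp hu.1) fun h => hu.2 ⟨hu.1, h⟩
  simp [SignedPatch.density, this]

/-! ### Change of charts -/

/-- The transition map between two charts is differentiable along the half-space, and its
derivative is the linear map that compares the two orientations. -/
theorem hasFDerivWithinAt_transition (hq : q ∈ Ω.charts)
    {u : Fin r → ℝ} (hu : u ∈ p.source) (huq : p.param u ∈ q.target)
    {A : (Fin r → ℝ) →L[ℝ] (Fin r → ℝ)}
    (hA : fderiv ℝ p.param u = (fderiv ℝ q.param (q.inv (p.param u))).comp A) :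
    HasFDerivWithinAt (q.inv ∘ p.param) A (p.source ∩ p.param ⁻¹' q.target) u := by
  set S := p.source ∩ p.param ⁻¹' q.target
  have huS : u ∈ S := ⟨hu, huq⟩
  have hinv : ∀ x ∈ q.target, q.inv x ∈ q.source ∧ q.param (q.inv x) = x := by
    rintro _ ⟨v, hv, rfl⟩
    rw [q.inv_param hv]
    exact ⟨hv, rfl⟩
  have hv := (hinv _ huq).1
  refine HasFDerivWithinAt.of_comp_of_isEmbedding (f := q.param)
    (f' := fderiv ℝ q.param (q.inv (p.param u))) (h := p.param) (t := univ) ?_ ?_ ?_ ?_ ?_ huS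
  · rw [nhdsWithin_univ]
    exact ((continuousOn_inv hq).comp
      (p.smooth.continuousOn.mono (inter_subset_left.trans inter_subset_left))
      inter_subset_right) u huS
  · exact (q.differentiableAt hv.1).hasFDerivAt.hasFDerivWithinAt
  · exact (LinearMap.isClosedEmbedding_of_injective
      (f := (fderiv ℝ q.param (q.inv (p.param u))).toLinearMap)
      (LinearMap.ker_eq_bot.2 (q.immersion _ hv))).isEmbedding
  · rw [← hA]
    exact (p.differentiableAt hu.1).hasFDerivAt.hasFDerivWithinAt
  · filter_upwards [self_mem_nhdsWithin] with w hw using (hinv _ hw.2).2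

/-- A form that lives on the overlap of two charts has the same integral over both of them. -/
theorem integral_patch_eq_of_overlap (hp : p ∈ Ω.charts) (hq : q ∈ Ω.charts) {η : DiffForm n r}
    (hηp : ∀ x ∈ Ω.carrier, x ∉ p.target → η x = 0)
    (hηq : ∀ x ∈ Ω.carrier, x ∉ q.target → η x = 0) : p.integral η = q.integral η := by
  -- both integrals reduce to the part of the domain that is mapped to the overlap
  have hred : ∀ {p q : SignedPatch n r}, p ∈ Ω.charts → q ∈ Ω.charts →
      (∀ x ∈ Ω.carrier, x ∉ q.target → η x = 0) →
      MeasurableSet (p.source ∩ p.param ⁻¹' q.target) ∧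
      ∫ u in p.source, p.density η u = ∫ u in p.source ∩ p.param ⁻¹' q.target, p.density η u := by
    intro p q hp hq h0
    obtain ⟨W, hW, hE⟩ := exists_isOpen_target hq
    constructor
    · have : p.source ∩ p.param ⁻¹' q.target = p.source ∩ p.param ⁻¹' W := by
        ext u
        simp only [mem_inter_iff, mem_preimage, hE]
        exact ⟨fun h => ⟨h.1, h.2.2⟩, fun h => ⟨h.1, param_mem hp h.1, h.2⟩⟩
      rw [this]
      exact p.measurableSet_source_inter_preimage hW
    · refine setIntegral_eq_of_subset_of_forall_sdiff_eq_zero p.measurableSet_source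
        inter_subset_left fun u hu => ?_
      have : η (p.param u) = 0 := h0 _ (param_mem hp hu.1) fun h => hu.2 ⟨hu.1, h⟩
      simp [SignedPatch.density, this]
  obtain ⟨hS, hpS⟩ := hred hp hq hηq
  obtain ⟨-, hqT⟩ := hred hq hp hηp
  set S := p.source ∩ p.param ⁻¹' q.target with hSdef
  set T := q.source ∩ q.param ⁻¹' p.target with hTdef
  have hex : ∀ u : Fin r → ℝ, ∃ A : (Fin r → ℝ) →L[ℝ] (Fin r → ℝ), u ∈ S →
      fderiv ℝ p.param u = (fderiv ℝ q.param (q.inv (p.param u))).comp A ∧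
        0 < (((p.sign * q.sign : ℤˣ) : ℤ) : ℝ) * A.det := by
    intro u
    by_cases hu : u ∈ S
    · obtain ⟨v, hv, hvu⟩ := hu.2
      obtain ⟨A, hA⟩ := Ω.oriented p hp q hq u hu.1 v hv hvu.symm
      refine ⟨A, fun _ => ?_⟩
      rwa [← hvu, q.inv_param hv]
    · exact ⟨0, fun h => (hu h).elim⟩
  choose A hA using hex
  have himage : (q.inv ∘ p.param) '' S = T := by
    ext v
    constructor
    · rintro ⟨u, ⟨hu, w, hw, hwu⟩, rfl⟩
      have hw' : q.inv (p.param u) = w := by rw [← hwu, q.inv_param hw]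
      simp only [Function.comp_apply, hw', hTdef]
      exact ⟨hw, by rw [mem_preimage, hwu]; exact mem_image_of_mem _ hu⟩
    · rintro ⟨hv, u, hu, huv⟩
      exact ⟨u, ⟨hu, by rw [mem_preimage, huv]; exact mem_image_of_mem _ hv⟩, by
        simp [huv, q.inv_param hv]⟩
  have hinj : InjOn (q.inv ∘ p.param) S := by
    rintro u ⟨hu, a, ha, hau⟩ v ⟨hv, b, hb, hbv⟩ huv
    refine p.injOn hu hv ?_
    simp only [Function.comp_apply, ← hau, ← hbv, q.inv_param ha, q.inv_param hb] at huv
    rw [← hau, ← hbv, huv]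
  have hcv := integral_image_eq_integral_abs_det_fderiv_smul volume hS
    (fun u hu => hasFDerivWithinAt_transition hq hu.1 hu.2 (hA u hu).1) hinj (q.density η)
  rw [himage] at hcv
  rw [SignedPatch.integral, SignedPatch.integral, hpS, hqT, hcv, ← integral_const_mul,
    ← integral_const_mul]
  refine setIntegral_congr_fun hS fun u hu => ?_
  obtain ⟨v, hv, hvu⟩ := hu.2
  have hvu' : q.inv (p.param u) = v := by rw [← hvu, q.inv_param hv]
  obtain ⟨h1, h2⟩ := hA u hu
  have hd : p.density η u = (A u).det * q.density η (q.inv (p.param u)) := by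
    simp only [SignedPatch.density, h1, ContinuousLinearMap.comp_apply, hvu', hvu]
    exact ContinuousAlternatingMap.map_comp_single _ _ _
  -- compatibility of the orientations turns the determinant into its absolute value
  have hs : ((p.sign : ℤ) : ℝ) * (A u).det = ((q.sign : ℤ) : ℝ) * |(A u).det| := by
    rcases Int.units_eq_one_or p.sign with h | h <;> rcases Int.units_eq_one_or q.sign with h' | h'
      <;> simp only [h, h'] at h2 ⊢ <;> norm_num at h2 ⊢
    · exact (abs_of_pos h2).symm
    · rw [abs_of_neg h2, neg_neg]
    · rw [abs_of_neg h2]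
    · exact (abs_of_pos h2).symm
  simp only [Function.comp_apply, smul_eq_mul]
  rw [hd, ← mul_assoc, hs, mul_assoc]

/-! ### The integral over a compact submanifold -/

theorem integral_eq_sum (ω : DiffForm n r) : Ω.integral ω =
    ∑ i, (Ω.partition.chart i).integral (fun x => Ω.partition.weight i x • ω x) := rfl

theorem isCompact_carrier_inter_tsupport (f : (Fin n → ℝ) → ℝ) :
    IsCompact (Ω.carrier ∩ tsupport f) :=
  Ω.isCompact.inter_right (isClosed_tsupport f)

theorem weight_smul_eq_zero (P : ChartPartition Ω) (ω : DiffForm n r) (i : Fin P.size)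
    {x : Fin n → ℝ} (hx : x ∈ Ω.carrier) (hxK : x ∉ Ω.carrier ∩ tsupport (P.weight i)) :
    P.weight i x • ω x = 0 := by
  rw [image_eq_zero_of_notMem_tsupport fun h => hxK ⟨hx, h⟩, zero_smul]

theorem integral_patch_congr (hp : p ∈ Ω.charts) {η θ : DiffForm n r}
    (h : EqOn η θ Ω.carrier) : p.integral η = p.integral θ := by
  rw [SignedPatch.integral, SignedPatch.integral]
  congr 1
  refine setIntegral_congr_fun p.measurableSet_source fun u hu => ?_
  simp only [SignedPatch.density, h (param_mem hp hu)]

theorem integral_congr {η θ : DiffForm n r} (h : EqOn η θ Ω.carrier) :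
    Ω.integral η = Ω.integral θ := by
  simp only [integral_eq_sum]
  exact Finset.sum_congr rfl fun i _ => integral_patch_congr (Ω.partition.chart_mem i)
    fun x hx => by simp only [h hx]

theorem integrableOn_density_weight (P : ChartPartition Ω) {η : DiffForm n r}
    (hη : ContinuousOn η Ω.carrier) (i : Fin P.size) :
    IntegrableOn ((P.chart i).density fun x => P.weight i x • η x) (P.chart i).source :=
  integrableOn_density (P.chart_mem i) ((P.smooth i).continuous.continuousOn.smul hη)
    (isCompact_carrier_inter_tsupport (P.weight i)) (P.support i)
    fun _ hx hxK => weight_smul_eq_zero P η i hx hxK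

theorem integral_sum {ι : Type*} (s : Finset ι) {η : ι → DiffForm n r}
    (hη : ∀ i ∈ s, ContinuousOn (η i) Ω.carrier) :
    Ω.integral (fun x => ∑ i ∈ s, η i x) = ∑ i ∈ s, Ω.integral (η i) := by
  simp only [integral_eq_sum]
  rw [Finset.sum_comm]
  refine Finset.sum_congr rfl fun j _ => ?_
  simp only [SignedPatch.integral]
  rw [← Finset.mul_sum, ← integral_finsetSum s fun i hi =>
    integrableOn_density_weight Ω.partition (hη i hi) j]
  congr 2
  ext u
  simp [SignedPatch.density, ContinuousAlternatingMap.sum_apply, Finset.mul_sum]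

theorem integral_add {η θ : DiffForm n r} (hη : ContinuousOn η Ω.carrier)
    (hθ : ContinuousOn θ Ω.carrier) :
    Ω.integral (fun x => η x + θ x) = Ω.integral η + Ω.integral θ := by
  have := Ω.integral_sum Finset.univ (η := ![η, θ]) (by
    intro i _
    fin_cases i
    · exact hη
    · exact hθ)
  simpa [Fin.sum_univ_two] using this

/-- The integral of a form that lives in the image of a chart can be computed in that chart; this is
why integrals do not depend on the partition of unity. -/
theorem integral_eq_integral_patch (hp : p ∈ Ω.charts) {η : DiffForm n r}
    (hη : ContinuousOn η Ω.carrier) {K : Set (Fin n → ℝ)} (hK : IsCompact K) (hKp : K ⊆ p.target)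
    (h0 : ∀ x ∈ Ω.carrier, x ∉ K → η x = 0) : Ω.integral η = p.integral η := by
  set P := Ω.partition with hP
  have hi : ∀ i, (P.chart i).integral (fun x => P.weight i x • η x) =
      p.integral (fun x => P.weight i x • η x) := fun i =>
    integral_patch_eq_of_overlap (P.chart_mem i) hp
      (fun x hx hxi => weight_smul_eq_zero P η i hx fun h => hxi (P.support i h))
      (fun x hx hxp => by rw [h0 x hx fun h => hxp (hKp h), smul_zero])
  rw [integral_eq_sum, Finset.sum_congr rfl fun i _ => hi i]
  have hint : ∀ i, IntegrableOn (p.density fun x => P.weight i x • η x) p.source := fun i =>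
    integrableOn_density hp ((P.smooth i).continuous.continuousOn.smul hη) hK hKp
      fun x hx hxK => by rw [h0 x hx hxK, smul_zero]
  simp only [SignedPatch.integral]
  rw [← Finset.mul_sum, ← integral_finsetSum _ fun i _ => hint i]
  congr 1
  refine setIntegral_congr_fun p.measurableSet_source fun u hu => ?_
  simp only [SignedPatch.density_smul, ← Finset.sum_mul]
  rw [P.sum_eq_one _ (param_mem hp hu), one_mul]

end OrientedCompactSubmanifold

/-! ### Derivatives of the flow and of the pulled back form -/

namespace IsFlow

variable {n m : ℕ} {M : Set (Fin n → ℝ)} {V : Fin m → (Fin n → ℝ) → (Fin n → ℝ)}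
  {φ : (Fin m → ℝ) → (Fin n → ℝ) → (Fin n → ℝ)}

theorem contDiffAt_uncurry (hφ : IsFlow M V φ) (hM : IsOpen M) (B : Fin m → ℝ)
    {x : Fin n → ℝ} (hx : x ∈ M) :
    ContDiffAt ℝ (⊤ : ℕ∞) (fun z : (Fin m → ℝ) × (Fin n → ℝ) => φ z.1 z.2) (B, x) :=
  hφ.smooth.contDiffAt ((isOpen_univ.prod hM).mem_nhds ⟨mem_univ _, hx⟩)

theorem differentiableAt_uncurry (hφ : IsFlow M V φ) (hM : IsOpen M) (B : Fin m → ℝ)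
    {x : Fin n → ℝ} (hx : x ∈ M) :
    DifferentiableAt ℝ (fun z : (Fin m → ℝ) × (Fin n → ℝ) => φ z.1 z.2) (B, x) :=
  (hφ.contDiffAt_uncurry hM B hx).differentiableAt (by simp)

theorem fderiv_eq_comp_inr (hφ : IsFlow M V φ) (hM : IsOpen M) (B : Fin m → ℝ)
    {x : Fin n → ℝ} (hx : x ∈ M) :
    fderiv ℝ (φ B) x = (fderiv ℝ (fun z : (Fin m → ℝ) × (Fin n → ℝ) => φ z.1 z.2) (B, x)).comp
      (ContinuousLinearMap.inr ℝ (Fin m → ℝ) (Fin n → ℝ)) :=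
  ((hφ.differentiableAt_uncurry hM B hx).hasFDerivAt.comp x
    (hasFDerivAt_prodMk_right B x)).fderiv

theorem hasFDerivAt_parameter (hφ : IsFlow M V φ) (hM : IsOpen M) (B : Fin m → ℝ)
    {x : Fin n → ℝ} (hx : x ∈ M) :
    HasFDerivAt (fun C => φ C x)
      ((fderiv ℝ (fun z : (Fin m → ℝ) × (Fin n → ℝ) => φ z.1 z.2) (B, x)).comp
        (ContinuousLinearMap.inl ℝ (Fin m → ℝ) (Fin n → ℝ))) B :=
  (hφ.differentiableAt_uncurry hM B hx).hasFDerivAt.comp (f := fun C => (C, x)) B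
    (hasFDerivAt_prodMk_left B x)

theorem fderiv_uncurry_single (hφ : IsFlow M V φ) (hM : IsOpen M) (B : Fin m → ℝ)
    {x : Fin n → ℝ} (hx : x ∈ M) (c : Fin m) :
    fderiv ℝ (fun z : (Fin m → ℝ) × (Fin n → ℝ) => φ z.1 z.2) (B, x) (Pi.single c 1, 0) =
      V c (φ B x) :=
  ((hφ.hasFDerivAt_parameter hM B hx).hasLineDerivAt (Pi.single c 1)).unique
    (hφ.hasLineDerivAt B x hx c)

theorem fderiv_zero (hφ : IsFlow M V φ) (hM : IsOpen M) {x : Fin n → ℝ} (hx : x ∈ M) :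
    fderiv ℝ (φ 0) x = ContinuousLinearMap.id ℝ (Fin n → ℝ) := by
  refine ((hasFDerivAt_id x).congr_of_eventuallyEq ?_).fderiv
  filter_upwards [hM.mem_nhds hx] with y hy using hφ.map_zero y hy

theorem hasDerivAt_smul_single (c : Fin m) (h : ℝ) :
    HasDerivAt (fun h : ℝ => h • (Pi.single c 1 : Fin m → ℝ)) (Pi.single c 1) h := by
  simpa using (hasDerivAt_id h).smul_const (Pi.single c 1 : Fin m → ℝ)

/-- The spatial differential of the flow is the identity at parameter `0`; to first order it changes
by the differential of the generating field, by the symmetry of second derivatives. -/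
theorem hasDerivAt_fderiv (hφ : IsFlow M V φ) (hM : IsOpen M) {x : Fin n → ℝ} (hx : x ∈ M)
    (c : Fin m) :
    HasDerivAt (fun h : ℝ => fderiv ℝ (φ (h • (Pi.single c 1 : Fin m → ℝ))) x)
      (fderiv ℝ (V c) x) 0 := by
  set Φ : (Fin m → ℝ) × (Fin n → ℝ) → (Fin n → ℝ) := fun z => φ z.1 z.2 with hΦ
  have hs := hφ.contDiffAt_uncurry hM 0 hx
  have h2 : DifferentiableAt ℝ (fderiv ℝ Φ) (0, x) :=
    (hs.fderiv_right (m := 1) (by norm_cast)).differentiableAt one_ne_zero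
  have hsymm : IsSymmSndFDerivAt ℝ Φ (0, x) :=
    hs.isSymmSndFDerivAt (by
      rw [minSmoothness_of_isRCLikeNormedField]
      exact WithTop.coe_le_coe.2 le_top)
  have hV : HasFDerivAt (V c) ((ContinuousLinearMap.apply ℝ (Fin n → ℝ)
      ((Pi.single c 1, 0) : (Fin m → ℝ) × (Fin n → ℝ))).comp
        ((fderiv ℝ (fderiv ℝ Φ) (0, x)).comp (ContinuousLinearMap.inr ℝ _ _))) x := by
    have h3 : HasFDerivAt (fun y => fderiv ℝ Φ (0, y)) ((fderiv ℝ (fderiv ℝ Φ) (0, x)).comp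
        (ContinuousLinearMap.inr ℝ (Fin m → ℝ) (Fin n → ℝ))) x :=
      h2.hasFDerivAt.comp x (hasFDerivAt_prodMk_right 0 x)
    refine ((ContinuousLinearMap.hasFDerivAt _).comp x h3).congr_of_eventuallyEq ?_
    filter_upwards [hM.mem_nhds hx] with y hy
    simp only [Function.comp_apply, ContinuousLinearMap.apply_apply]
    rw [hφ.fderiv_uncurry_single hM 0 hy, hφ.map_zero y hy]
  have h4 : HasDerivAt (fun h : ℝ => fderiv ℝ Φ (h • (Pi.single c 1 : Fin m → ℝ), x))
      (fderiv ℝ (fderiv ℝ Φ) (0, x) (Pi.single c 1, 0)) 0 := by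
    have h5 : HasDerivAt (fun h : ℝ => (h • (Pi.single c 1 : Fin m → ℝ), x))
        ((Pi.single c 1, 0) : (Fin m → ℝ) × (Fin n → ℝ)) 0 :=
      (hasDerivAt_smul_single c 0).prodMk (hasDerivAt_const 0 x)
    have h2' : HasFDerivAt (fderiv ℝ Φ) (fderiv ℝ (fderiv ℝ Φ) (0, x))
        ((0 : ℝ) • (Pi.single c 1 : Fin m → ℝ), x) := by
      rw [zero_smul]; exact h2.hasFDerivAt
    exact h2'.comp_hasDerivAt 0 h5
  have h6 := h4.clm_comp (hasDerivAt_const (0 : ℝ)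
    (ContinuousLinearMap.inr ℝ (Fin m → ℝ) (Fin n → ℝ)))
  convert! h6 using 1
  · ext1 h
    exact hφ.fderiv_eq_comp_inr hM _ hx
  · rw [hV.fderiv]
    ext v : 1
    simp [hsymm.eq (0, v) (Pi.single c 1, 0)]

theorem hasDerivAt_flow (hφ : IsFlow M V φ) {x : Fin n → ℝ} (hx : x ∈ M) (c : Fin m) :
    HasDerivAt (fun h : ℝ => φ (h • (Pi.single c 1 : Fin m → ℝ)) x) (V c x) 0 := by
  have := hφ.hasLineDerivAt 0 x hx c
  simpa [HasLineDerivAt, hφ.map_zero x hx] using this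

/-- The derivative of the pulled back form, before the terms are arranged as in Cartan's formula. -/
theorem exists_hasDerivAt_pullbackForm (hφ : IsFlow M V φ) (hM : IsOpen M) {x : Fin n → ℝ}
    (hx : x ∈ M) (c : Fin m) {r : ℕ} {ω : DiffForm n r} (hω : DifferentiableAt ℝ ω x) :
    ∃ L : (Fin n → ℝ) [⋀^Fin r]→L[ℝ] ℝ,
      HasDerivAt (fun h : ℝ => pullbackForm (φ (h • (Pi.single c 1 : Fin m → ℝ))) ω x) L 0 ∧
      ∀ v, L v = fderiv ℝ ω x (V c x) v +
        ∑ i, ω x (Function.update v i (fderiv ℝ (V c) x (v i))) := by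
  have h0 : φ ((0 : ℝ) • (Pi.single c 1 : Fin m → ℝ)) x = x := by
    rw [zero_smul, hφ.map_zero x hx]
  have h1 : HasDerivAt (fun h : ℝ => ω (φ (h • (Pi.single c 1 : Fin m → ℝ)) x))
      (fderiv ℝ ω x (V c x)) 0 := by
    have hω' : HasFDerivAt ω (fderiv ℝ ω x) (φ ((0 : ℝ) • (Pi.single c 1 : Fin m → ℝ)) x) := by
      rw [h0]; exact hω.hasFDerivAt
    exact hω'.comp_hasDerivAt 0 (hφ.hasDerivAt_flow hx c)
  have h2 := (h1.hasFDerivAt.continuousAlternatingMapCompContinuousLinearMap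
    (hφ.hasDerivAt_fderiv hM hx c).hasFDerivAt).hasDerivAt
  refine ⟨_, h2, fun v => ?_⟩
  simp only [zero_smul, hφ.map_zero x hx, hφ.fderiv_zero hM hx]
  simp only [add_apply, ContinuousLinearMap.comp_apply, ContinuousAlternatingMap.add_apply,
    ContinuousAlternatingMap.fderivCompContinuousLinearMap_apply]
  congr 1
  · simp [ContinuousAlternatingMap.compContinuousLinearMapCLM]
  · refine Finset.sum_congr rfl fun i _ => congrArg _ ?_
    ext1 j
    rcases eq_or_ne j i with rfl | hj
    · simp
    · simp [Function.update_of_ne hj]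

end IsFlow

/-! ### Cartan's formula -/

section CurryLeft

variable {E : Type*} [NormedAddCommGroup E] [NormedSpace ℝ E] {r : ℕ} {X : E → E}
  {ω : E → E [⋀^Fin (r + 1)]→L[ℝ] ℝ} {x : E}

set_option maxSynthPendingDepth 3 in
theorem contDiffAt_curryLeft {k : WithTop ℕ∞} (hX : ContDiffAt ℝ k X x)
    (hω : ContDiffAt ℝ k ω x) : ContDiffAt ℝ k (fun y => (ω y).curryLeft (X y)) x :=
  ((ContinuousAlternatingMap.curryLeftLI (𝕜 := ℝ) (E := E) (F := ℝ)
    (n := r)).toContinuousLinearMap.contDiff.contDiffAt.comp x hω).clm_apply hX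

set_option maxSynthPendingDepth 3 in
theorem continuousAt_curryLeft (hX : ContinuousAt X x) (hω : ContinuousAt ω x) :
    ContinuousAt (fun y => (ω y).curryLeft (X y)) x :=
  ((ContinuousAlternatingMap.curryLeftLI (𝕜 := ℝ) (E := E) (F := ℝ)
    (n := r)).toContinuousLinearMap.continuous.continuousAt.comp hω).clm_apply hX

set_option maxSynthPendingDepth 3 in
theorem fderiv_curryLeft (hX : DifferentiableAt ℝ X x) (hω : DifferentiableAt ℝ ω x) (w : E) :
    fderiv ℝ (fun y => (ω y).curryLeft (X y)) x w =
      (fderiv ℝ ω x w).curryLeft (X x) + (ω x).curryLeft (fderiv ℝ X x w) := by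
  set L := (ContinuousAlternatingMap.curryLeftLI (𝕜 := ℝ) (E := E) (F := ℝ)
    (n := r)).toContinuousLinearMap
  have hL : ∀ T, L T = T.curryLeft := fun _ => rfl
  have h1 : HasFDerivAt (fun y => (ω y).curryLeft) (L.comp (fderiv ℝ ω x)) x :=
    L.hasFDerivAt.comp x hω.hasFDerivAt
  rw [(h1.clm_apply hX.hasFDerivAt).fderiv]
  simp [add_comm, hL]

end CurryLeft

/-- Cartan's formula, evaluated on vectors and with the Lie derivative written out. -/
theorem cartan_apply {n r : ℕ} {X : (Fin n → ℝ) → (Fin n → ℝ)} {ω : DiffForm n r}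
    {x : Fin n → ℝ} (hX : DifferentiableAt ℝ X x) (hω : DifferentiableAt ℝ ω x)
    (v : Fin r → Fin n → ℝ) :
    (interiorProductExtDeriv X ω x + extDerivInteriorProduct X ω x) v =
      fderiv ℝ ω x (X x) v + ∑ i, ω x (Function.update v i (fderiv ℝ X x (v i))) := by
  cases r with
  | zero =>
    simp [interiorProductExtDeriv, extDerivInteriorProduct, interiorProduct, extDeriv,
      ContinuousAlternatingMap.alternatizeUncurryFin_apply]
  | succ r =>
    simp only [interiorProductExtDeriv, extDerivInteriorProduct, interiorProduct, extDeriv,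
      ContinuousAlternatingMap.add_apply, ContinuousAlternatingMap.curryLeft_apply_apply,
      ContinuousAlternatingMap.alternatizeUncurryFin_apply]
    rw [Fin.sum_univ_succ, add_assoc]
    congr 1
    · simp
    · rw [← Finset.sum_add_distrib]
      refine Finset.sum_congr rfl fun i _ => ?_
      rw [fderiv_curryLeft hX hω, ContinuousAlternatingMap.add_apply, smul_add,
        ContinuousAlternatingMap.curryLeft_apply_apply,
        ContinuousAlternatingMap.curryLeft_apply_apply]
      have h1 := AlternatingMap.neg_one_pow_smul_map_insertNth (ω x).toAlternatingMap i
        (fderiv ℝ X x (v i)) (i.removeNth v)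
      rw [Fin.insertNth_removeNth] at h1
      have h2 : (-1 : ℤ) ^ (i : ℕ) • ω x (Matrix.vecCons (fderiv ℝ X x (v i)) (i.removeNth v)) =
          ω x (Function.update v i (fderiv ℝ X x (v i))) := by
        have h3 : ω x (Matrix.vecCons (fderiv ℝ X x (v i)) (i.removeNth v)) =
            (-1 : ℤ) ^ (i : ℕ) • ω x (Function.update v i (fderiv ℝ X x (v i))) := by
          simpa using h1.symm
        rw [h3, smul_smul, ← mul_pow]
        simp
      -- the terms that differentiate `ω` along `vᵢ` cancel
      have h4 : i.succ.removeNth (Matrix.vecCons (X x) v) =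
          Matrix.vecCons (X x) (i.removeNth v) := by
        ext1 j
        refine Fin.cases ?_ (fun k => ?_) j
        · simp [Fin.removeNth]
        · simp [Fin.removeNth]
      rw [h2, h4]
      simp [pow_succ]

/-! ### Pulling back by the flow, in charts -/

namespace IsFlow

variable {n m : ℕ} {M : Set (Fin n → ℝ)} {V : Fin m → (Fin n → ℝ) → (Fin n → ℝ)}
  {φ : (Fin m → ℝ) → (Fin n → ℝ) → (Fin n → ℝ)}

/-- The Lie derivative exists and is given by Cartan's formula. -/
theorem hasDerivAt_pullbackForm (hφ : IsFlow M V φ) (hM : IsOpen M)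
    (hV : ∀ c, ContDiffOn ℝ (⊤ : ℕ∞) (V c) M) {x : Fin n → ℝ}
    (hx : x ∈ M) (c : Fin m) {r : ℕ} {ω : DiffForm n r} (hω : DifferentiableAt ℝ ω x) :
    HasDerivAt (fun h : ℝ => pullbackForm (φ (h • (Pi.single c 1 : Fin m → ℝ))) ω x)
      (interiorProductExtDeriv (V c) ω x + extDerivInteriorProduct (V c) ω x) 0 := by
  obtain ⟨L, hL, hLv⟩ := hφ.exists_hasDerivAt_pullbackForm hM hx c hω
  have hX : DifferentiableAt ℝ (V c) x :=
    ((hV c).contDiffAt (hM.mem_nhds hx)).differentiableAt (by simp)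
  have : interiorProductExtDeriv (V c) ω x + extDerivInteriorProduct (V c) ω x = L := by
    ext v
    rw [hLv, cartan_apply hX hω]
  rwa [this]

/-- In a chart, the coefficient of `(φ^B)^* ω` is jointly of class `C¹` in `B` and the point,
although it involves a spatial derivative of the flow, since the flow is smooth. -/
theorem contDiffAt_density (hφ : IsFlow M V φ) (hM : IsOpen M) {r : ℕ} (p : SignedPatch n r)
    {u : Fin r → ℝ} (hu : u ∈ p.dom) (huM : p.param u ∈ M) {ω : DiffForm n r}
    (hω : ContDiffAt ℝ 1 ω (p.param u)) :
    ContDiffAt ℝ 1 (fun z : (Fin m → ℝ) × (Fin r → ℝ) =>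
      p.density (pullbackForm (φ z.1) ω) z.2) (0, u) := by
  set Φ : (Fin m → ℝ) × (Fin n → ℝ) → (Fin n → ℝ) := fun z => φ z.1 z.2 with hΦ
  have hψ : ContDiffAt ℝ (⊤ : ℕ∞) (fun z : (Fin m → ℝ) × (Fin r → ℝ) => p.param z.2) (0, u) :=
    (p.contDiffAt hu).comp (0, u) contDiffAt_snd
  have hψ' : ContDiffAt ℝ (⊤ : ℕ∞) (fun z : (Fin m → ℝ) × (Fin r → ℝ) => (z.1, p.param z.2))
      (0, u) := contDiffAt_fst.prodMk hψ
  have hΦs : ContDiffAt ℝ (⊤ : ℕ∞) Φ (0, p.param u) := hφ.contDiffAt_uncurry hM 0 huM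
  have h1 : ContDiffAt ℝ 1 (fun z : (Fin m → ℝ) × (Fin r → ℝ) => ω (φ z.1 (p.param z.2)))
      (0, u) := by
    have hω' : ContDiffAt ℝ 1 ω (φ 0 (p.param u)) := by rwa [hφ.map_zero _ huM]
    exact hω'.comp (f := fun z : (Fin m → ℝ) × (Fin r → ℝ) => φ z.1 (p.param z.2)) (0, u)
      ((hΦs.comp (f := fun z : (Fin m → ℝ) × (Fin r → ℝ) => (z.1, p.param z.2)) (0, u) hψ').of_le
        (by norm_cast))
  have h2 : ContDiffAt ℝ 1 (fun z : (Fin m → ℝ) × (Fin r → ℝ) =>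
      fderiv ℝ Φ (z.1, p.param z.2)) (0, u) :=
    (hΦs.fderiv_right (m := 1) (by norm_cast)).comp
      (f := fun z : (Fin m → ℝ) × (Fin r → ℝ) => (z.1, p.param z.2)) (0, u)
      (hψ'.of_le (by norm_cast))
  have h3 : ContDiffAt ℝ 1 (fun z : (Fin m → ℝ) × (Fin r → ℝ) => fderiv ℝ p.param z.2) (0, u) :=
    ((p.contDiffAt hu).fderiv_right (m := 1) (by norm_cast)).comp (0, u) contDiffAt_snd
  have h4 : ContDiffAt ℝ 1 (fun z : (Fin m → ℝ) × (Fin r → ℝ) => fun j : Fin r =>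
      fderiv ℝ Φ (z.1, p.param z.2) (0, fderiv ℝ p.param z.2 (Pi.single j 1))) (0, u) :=
    contDiffAt_pi.2 fun j => h2.clm_apply (contDiffAt_const.prodMk (h3.clm_apply contDiffAt_const))
  refine (contDiff_continuousAlternatingMap_apply.contDiffAt.comp (0, u)
    (h1.prodMk h4)).congr_of_eventuallyEq ?_
  filter_upwards [hψ.continuousAt.preimage_mem_nhds (hM.mem_nhds huM)] with z hz
  simp only [SignedPatch.density, pullbackForm, Function.comp_apply,
    ContinuousAlternatingMap.compContinuousLinearMap_apply]
  congr 1
  ext1 j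
  simp only [Function.comp_apply]
  rw [hφ.fderiv_eq_comp_inr hM _ hz]
  simp [hΦ]

end IsFlow

/-! ### Differentiation under the integral sign -/

/-- Differentiation under the integral sign over a compact set, for an integrand that is jointly of
class `C¹` at the points that matter. -/
theorem hasFDerivAt_integral_of_contDiffAt {E F : Type*} [NormedAddCommGroup E] [NormedSpace ℝ E]
    [NormedAddCommGroup F] [NormedSpace ℝ F] [MeasurableSpace F] [BorelSpace F]
    (μ : Measure F) [IsFiniteMeasureOnCompacts μ] {K : Set F} (hK : IsCompact K)
    {f : E → F → ℝ} {x₀ : E}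
    (hf : ∀ u ∈ K, ContDiffAt ℝ 1 (fun z : E × F => f z.1 z.2) (x₀, u)) :
    IntegrableOn (fun u => fderiv ℝ (fun x => f x u) x₀) K μ ∧
    HasFDerivAt (fun x => ∫ u in K, f x u ∂μ)
      (∫ u in K, fderiv ℝ (fun x => f x u) x₀ ∂μ) x₀ := by
  set g : E × F → ℝ := fun z => f z.1 z.2 with hg
  -- the partial derivative, as a continuous function on the set where `g` is of class `C¹`
  set G : E × F → E →L[ℝ] ℝ := fun z => (fderiv ℝ g z).comp (ContinuousLinearMap.inl ℝ E F) with hG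
  have hGc : ∀ z, ContDiffAt ℝ 1 g z → ContinuousAt G z := fun z hz =>
    ((hz.fderiv_right (m := 0) (by norm_num)).continuousAt).clm_comp continuousAt_const
  have hGd : ∀ x u, ContDiffAt ℝ 1 g (x, u) → HasFDerivAt (fun y => f y u) (G (x, u)) x :=
    fun x u h => (h.differentiableAt one_ne_zero).hasFDerivAt.comp (f := fun y => (y, u)) x
      (hasFDerivAt_prodMk_left x u)
  obtain ⟨R, hR⟩ : ∃ R : ℝ, ∀ u ∈ K, ‖G (x₀, u)‖ < R := by
    have hc : ContinuousOn (fun u => ‖G (x₀, u)‖) K := fun u hu =>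
      ((hGc _ (hf u hu)).comp (f := fun v => (x₀, v)) (by fun_prop)).norm.continuousWithinAt
    obtain ⟨R, hR⟩ := hK.bddAbove_image hc
    exact ⟨R + 1, fun u hu => lt_of_le_of_lt (hR (mem_image_of_mem _ hu)) (lt_add_one R)⟩
  have hev : ∀ᶠ x in nhds x₀, ∀ u ∈ K, ContDiffAt ℝ 1 g (x, u) ∧ ‖G (x, u)‖ < R := by
    refine hK.eventually_forall_of_forall_eventually fun u hu => ?_
    exact ((hf u hu).eventually (by simp)).and
      ((hGc _ (hf u hu)).norm.eventually_lt continuousAt_const (hR u hu))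
  have hev' : {x | ∀ u ∈ K, ContDiffAt ℝ 1 g (x, u) ∧ ‖G (x, u)‖ < R} ∈ nhds x₀ := hev
  have hmeas : ∀ x, (∀ u ∈ K, ContDiffAt ℝ 1 g (x, u)) → ContinuousOn (f x) K := fun x hx u hu =>
    ((hx u hu).continuousAt.comp (f := fun v => (x, v)) (by fun_prop)).continuousWithinAt
  have hGK : ContinuousOn (fun u => G (x₀, u)) K := fun u hu =>
    ((hGc _ (hf u hu)).comp (f := fun v => (x₀, v)) (by fun_prop)).continuousWithinAt
  have heq : EqOn (fun u => fderiv ℝ (fun x => f x u) x₀) (fun u => G (x₀, u)) K :=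
    fun u hu => (hGd _ _ (hf u hu)).fderiv
  refine ⟨(hGK.integrableOn_compact hK).congr_fun heq.symm hK.measurableSet, ?_⟩
  rw [setIntegral_congr_fun hK.measurableSet heq]
  refine hasFDerivAt_integral_of_dominated_of_fderiv_le (F' := fun x u => G (x, u))
    (bound := fun _ => R) hev' ?_ ((hmeas x₀ hf).integrableOn_compact hK)
    (hGK.aestronglyMeasurable_of_isCompact hK hK.measurableSet) ?_ ?_ ?_
  · filter_upwards [hev] with x hx
    exact (hmeas x fun u hu => (hx u hu).1).aestronglyMeasurable_of_isCompact hK hK.measurableSet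
  · filter_upwards [ae_restrict_mem hK.measurableSet] with u hu x hx using (hx u hu).2.le
  · exact integrableOn_const hK.measure_lt_top.ne
  · filter_upwards [ae_restrict_mem hK.measurableSet] with u hu x hx using hGd _ _ (hx u hu).1

/-! ### The derivative of the transported integral -/

namespace OrientedCompactSubmanifold

variable {n r : ℕ} {Ω : OrientedCompactSubmanifold n r} {p : SignedPatch n r}

/-- The integral over a patch only involves a compact piece of its domain. -/
theorem integral_patch_eq_setIntegral_compact (hp : p ∈ Ω.charts) {η : DiffForm n r}
    {K : Set (Fin n → ℝ)} (h0 : ∀ x ∈ Ω.carrier, x ∉ K → η x = 0) :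
    p.integral η = ((p.sign : ℤ) : ℝ) * ∫ u in p.source ∩ p.param ⁻¹' K, p.density η u := by
  rw [SignedPatch.integral, setIntegral_eq_of_subset_of_forall_sdiff_eq_zero
    p.measurableSet_source inter_subset_left fun u hu => ?_]
  have : η (p.param u) = 0 := h0 _ (param_mem hp hu.1) fun h => hu.2 ⟨hu.1, h⟩
  simp [SignedPatch.density, this]

end OrientedCompactSubmanifold

@[simp]
theorem dotDC_single {m : ℕ} (a : Fin m → ℝ) (c : Fin m) : dotDC a (Pi.single c 1) = a c := by
  simp [dotDC, Pi.single_apply]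

namespace IsFlow

open OrientedCompactSubmanifold

variable {n m r : ℕ} {M : Set (Fin n → ℝ)} {V : Fin m → (Fin n → ℝ) → (Fin n → ℝ)}
  {φ : (Fin m → ℝ) → (Fin n → ℝ) → (Fin n → ℝ)}

theorem map_sub_comp (hφ : IsFlow M V φ) (B C : Fin m → ℝ) {s : Fin n → ℝ} (hs : s ∈ M) :
    φ (B - C) (φ C s) = φ B s := by
  rw [hφ.map_add s hs, sub_add_cancel]

/-- Both patches have the same domain, and their parametrizations differ by `φ^{B - C}`. -/
theorem integral_movePatch (hφ : IsFlow M V φ) (hM : IsOpen M) (B C : Fin m → ℝ)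
    (p : SignedPatch n r) (η : DiffForm n r) : (hφ.movePatch hM B p).integral η =
      (hφ.movePatch hM C p).integral (pullbackForm (φ (B - C)) η) := by
  have hsign : (hφ.movePatch hM B p).sign = (hφ.movePatch hM C p).sign := rfl
  have hsource : (hφ.movePatch hM B p).source = (hφ.movePatch hM C p).source := rfl
  rw [SignedPatch.integral, SignedPatch.integral, hsign, hsource]
  congr 1
  refine setIntegral_congr_fun (SignedPatch.measurableSet_source _) fun u hu => ?_
  have huM : p.param u ∈ M := hu.1.2
  have hev : (hφ.movePatch hM B p).param =ᶠ[nhds u]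
      φ (B - C) ∘ (hφ.movePatch hM C p).param := by
    filter_upwards [(hφ.movePatch hM C p).isOpen_dom.mem_nhds hu.1] with w hw
    exact (hφ.map_sub_comp B C hw.2).symm
  have hd : fderiv ℝ (hφ.movePatch hM B p).param u =
      (fderiv ℝ (φ (B - C)) ((hφ.movePatch hM C p).param u)).comp
        (fderiv ℝ (hφ.movePatch hM C p).param u) := by
    rw [hev.fderiv_eq]
    exact fderiv_comp u (hφ.differentiableAt hM _ (hφ.mapsTo C huM))
      ((hφ.movePatch hM C p).differentiableAt hu.1)
  simp only [SignedPatch.density, pullbackForm, hd, hev.eq_of_nhds,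
    ContinuousAlternatingMap.compContinuousLinearMap_apply, Function.comp_def,
    ContinuousLinearMap.comp_apply]

/-- Change of variables under the flow: the integral over `Ω(B)` is an integral over `Ω(C)`. -/
theorem integral_move (hφ : IsFlow M V φ) (hM : IsOpen M) (Ω : OrientedCompactSubmanifold n r)
    (hΩ : Ω.carrier ⊆ M) (B C : Fin m → ℝ) {ω : DiffForm n r}
    (hω : ContinuousOn ω (φ B '' Ω.carrier)) : (hφ.move hM Ω hΩ B).integral ω =
      (hφ.move hM Ω hΩ C).integral (pullbackForm (φ (B - C)) ω) := by
  set P := (hφ.move hM Ω hΩ C).partition with hP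
  have hback : ∀ s ∈ M, φ (C - B) (φ B s) = φ C s := fun s hs => hφ.map_sub_comp C B hs
  have hmaps : MapsTo (φ (C - B)) (φ B '' Ω.carrier) (φ C '' Ω.carrier) := by
    rintro _ ⟨s, hs, rfl⟩
    exact ⟨s, hs, (hback s (hΩ hs)).symm⟩
  have hBM : φ B '' Ω.carrier ⊆ M := by
    rintro _ ⟨s, hs, rfl⟩
    exact hφ.mapsTo B (hΩ hs)
  have hCM : φ C '' Ω.carrier ⊆ M := by
    rintro _ ⟨s, hs, rfl⟩
    exact hφ.mapsTo C (hΩ hs)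
  -- the partition of unity of `Ω(C)`, carried over to `Ω(B)`
  set η : Fin P.size → DiffForm n r := fun i x => P.weight i (φ (C - B) x) • ω x with hη
  have hηc : ∀ i, ContinuousOn (η i) (hφ.move hM Ω hΩ B).carrier := fun i =>
    ((P.smooth i).continuous.comp_continuousOn ((hφ.contDiffOn (C - B)).continuousOn.mono
      hBM)).smul hω
  have h1 : (hφ.move hM Ω hΩ B).integral ω =
      (hφ.move hM Ω hΩ B).integral (fun x => ∑ i, η i x) := by
    refine integral_congr fun x hx => ?_
    simp only [hη, ← Finset.sum_smul]
    rw [P.sum_eq_one _ (hmaps hx), one_smul]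
  rw [h1, OrientedCompactSubmanifold.integral_sum _ fun i _ => hηc i, integral_eq_sum]
  refine Finset.sum_congr rfl fun i _ => ?_
  obtain ⟨p, hp, hpi⟩ := P.chart_mem i
  have hsup := P.support i
  rw [← hpi] at hsup
  have hK : IsCompact (φ (B - C) '' ((φ C '' Ω.carrier) ∩ tsupport (P.weight i))) :=
    ((hφ.move hM Ω hΩ C).isCompact.inter_right (isClosed_tsupport _)).image_of_continuousOn
      ((hφ.contDiffOn (B - C)).continuousOn.mono (inter_subset_left.trans hCM))
  rw [integral_eq_integral_patch (Ω := hφ.move hM Ω hΩ B) (p := hφ.movePatch hM B p)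
    ⟨p, hp, rfl⟩ (hηc i) hK,
    hφ.integral_movePatch hM B C]
  · change _ = (P.chart i).integral fun x => P.weight i x • pullbackForm (φ (B - C)) ω x
    rw [← hpi]
    refine integral_patch_congr (Ω := hφ.move hM Ω hΩ C) ⟨p, hp, rfl⟩ ?_
    rintro _ ⟨s, hs, rfl⟩
    simp only [pullbackForm, hη]
    rw [hφ.map_sub_comp B C (hΩ hs), hback s (hΩ hs)]
    rfl
  · rintro _ ⟨x, hx, rfl⟩
    obtain ⟨u, hu, rfl⟩ := hsup hx
    exact ⟨u, hu, (hφ.map_sub_comp B C hu.1.2).symm⟩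
  · rintro _ ⟨s, hs, rfl⟩ hsK
    have hw : P.weight i (φ C s) = 0 := image_eq_zero_of_notMem_tsupport
      fun h => hsK ⟨φ C s, ⟨⟨s, hs, rfl⟩, h⟩, hφ.map_sub_comp B C (hΩ hs)⟩
    simp only [hη]
    rw [hback s (hΩ hs), hw, zero_smul]

/-- In a chart, the partial derivatives in `B` of `(φ^B)^* ω` are the Lie derivatives of `ω`. -/
theorem fderiv_density_single (hφ : IsFlow M V φ) (hM : IsOpen M)
    (hV : ∀ c, ContDiffOn ℝ (⊤ : ℕ∞) (V c) M) (p : SignedPatch n r)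
    {u : Fin r → ℝ} (hu : u ∈ p.dom) (huM : p.param u ∈ M) {ω : DiffForm n r}
    (hω : ContDiffAt ℝ 1 ω (p.param u)) (c : Fin m) :
    fderiv ℝ (fun B => p.density (pullbackForm (φ B) ω) u) 0 (Pi.single c 1) =
      p.density (lieDerivative φ c ω) u := by
  have h1 := hφ.hasDerivAt_pullbackForm hM hV huM c (hω.differentiableAt one_ne_zero)
  have h2 : HasDerivAt (fun h : ℝ => p.density
      (pullbackForm (φ (h • (Pi.single c 1 : Fin m → ℝ))) ω) u)
      (p.density (lieDerivative φ c ω) u) 0 := by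
    simp only [SignedPatch.density, lieDerivative]
    rw [h1.deriv]
    have h3 := h1.hasFDerivAt.continuousAlternatingMap_apply
      (g := fun j _ => fderiv ℝ p.param u (Pi.single j 1)) (g' := fun _ => 0)
      (fun j => hasFDerivAt_const _ _)
    simpa using h3.hasDerivAt
  have h4 : DifferentiableAt ℝ (fun B => p.density (pullbackForm (φ B) ω) u) 0 :=
    ((hφ.contDiffAt_density hM p hu huM hω).differentiableAt one_ne_zero).comp
      (f := fun B => (B, u)) 0 (by fun_prop)
  have h5 : HasFDerivAt (fun B => p.density (pullbackForm (φ B) ω) u)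
      (fderiv ℝ (fun B => p.density (pullbackForm (φ B) ω) u) 0)
      ((0 : ℝ) • (Pi.single c 1 : Fin m → ℝ)) := by
    rw [zero_smul]
    exact h4.hasFDerivAt
  have h6 := HasFDerivAt.comp_hasDerivAt (l := fun B => p.density (pullbackForm (φ B) ω) u)
    (f := fun h : ℝ => h • (Pi.single c 1 : Fin m → ℝ)) 0 h5 (hasDerivAt_smul_single c 0)
  exact h6.unique h2

/-- The integral of the pulled back form is differentiable in the flow parameter; its derivative is
found by differentiating under the integral sign. -/
theorem hasFDerivAt_integral_pullbackForm (hφ : IsFlow M V φ) (hM : IsOpen M)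
    (hV : ∀ c, ContDiffOn ℝ (⊤ : ℕ∞) (V c) M) (Ω : OrientedCompactSubmanifold n r)
    (hΩ : Ω.carrier ⊆ M) {ω : DiffForm n r} (hω : ∀ x ∈ Ω.carrier, ContDiffAt ℝ 1 ω x) :
    HasFDerivAt (fun B => Ω.integral (pullbackForm (φ B) ω))
      (dotDC fun c => Ω.integral (lieDerivative φ c ω)) 0 := by
  set P := Ω.partition with hP
  set S : Fin P.size → Set (Fin r → ℝ) := fun i => (P.chart i).source ∩
    (P.chart i).param ⁻¹' (Ω.carrier ∩ tsupport (P.weight i)) with hS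
  have hS_compact : ∀ i, IsCompact (S i) := fun i =>
    isCompact_source_inter_preimage (P.chart_mem i)
      (isCompact_carrier_inter_tsupport (P.weight i)) (P.support i)
  set f : Fin P.size → (Fin m → ℝ) → (Fin r → ℝ) → ℝ := fun i B u =>
    P.weight i ((P.chart i).param u) * (P.chart i).density (pullbackForm (φ B) ω) u with hf
  have hint : ∀ η : DiffForm n r, Ω.integral η = ∑ i, (((P.chart i).sign : ℤ) : ℝ) *
      ∫ u in S i, P.weight i ((P.chart i).param u) * (P.chart i).density η u := fun η => by
    rw [integral_eq_sum]
    refine Finset.sum_congr rfl fun i _ => ?_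
    exact integral_patch_eq_setIntegral_compact (P.chart_mem i)
      fun x hx hxK => weight_smul_eq_zero P η i hx hxK
  have hfs : ∀ i, ∀ u ∈ S i,
      ContDiffAt ℝ 1 (fun z : (Fin m → ℝ) × (Fin r → ℝ) => f i z.1 z.2) (0, u) := by
    intro i u hu
    have h1 : ContDiffAt ℝ 1 (fun z : (Fin m → ℝ) × (Fin r → ℝ) =>
        P.weight i ((P.chart i).param z.2)) (0, u) :=
      (((P.smooth i).contDiffAt.comp u ((P.chart i).contDiffAt hu.1.1)).of_le
        (by norm_cast)).comp (f := fun z : (Fin m → ℝ) × (Fin r → ℝ) => z.2) (0, u) contDiffAt_snd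
    exact h1.mul (hφ.contDiffAt_density hM _ hu.1.1 (hΩ hu.2.1) (hω _ hu.2.1))
  have hmain := fun i => hasFDerivAt_integral_of_contDiffAt volume (hS_compact i) (hfs i)
  have hsum : HasFDerivAt (fun B => Ω.integral (pullbackForm (φ B) ω))
      (∑ i, (((P.chart i).sign : ℤ) : ℝ) • ∫ u in S i, fderiv ℝ (fun B => f i B u) 0) 0 := by
    simp only [hint]
    exact HasFDerivAt.fun_sum fun i _ => (hmain i).2.const_mul _
  refine hsum.congr_fderiv ?_
  refine ContinuousLinearMap.coe_injective (LinearMap.pi_ext' fun c => LinearMap.ext_ring ?_)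
  simp only [LinearMap.comp_apply, LinearMap.coe_single, ContinuousLinearMap.coe_coe]
  rw [dotDC_single, hint]
  simp only [sum_apply, smul_apply, smul_eq_mul]
  refine Finset.sum_congr rfl fun i _ => ?_
  rw [ContinuousLinearMap.integral_apply (hmain i).1]
  congr 1
  refine setIntegral_congr_fun (hS_compact i).measurableSet fun u hu => ?_
  have h4 : DifferentiableAt ℝ (fun B => (P.chart i).density (pullbackForm (φ B) ω) u) 0 :=
    ((hφ.contDiffAt_density hM _ hu.1.1 (hΩ hu.2.1) (hω _ hu.2.1)).differentiableAt
      one_ne_zero).comp (f := fun B => (B, u)) 0 (by fun_prop)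
  simp only [hf]
  rw [fderiv_const_mul h4, smul_apply, smul_eq_mul,
    hφ.fderiv_density_single hM hV _ hu.1.1 (hΩ hu.2.1) (hω _ hu.2.1)]

/-- Regularity of `ω` near the compact set `Ω(C)` gives regularity near `Ω(B)` for `B` near `C`. -/
theorem eventually_contDiffAt (hφ : IsFlow M V φ) (hM : IsOpen M) {K : Set (Fin n → ℝ)}
    (hK : IsCompact K) (hKM : K ⊆ M) {ω : DiffForm n r} {C : Fin m → ℝ}
    (hω : ∀ x ∈ φ C '' K, ContDiffAt ℝ 1 ω x) :
    ∀ᶠ B in nhds C, ∀ x ∈ φ B '' K, ContDiffAt ℝ 1 ω x := by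
  have : ∀ᶠ B in nhds C, ∀ s ∈ K, ContDiffAt ℝ 1 ω (φ B s) := by
    refine hK.eventually_forall_of_forall_eventually fun s hs => ?_
    exact (hφ.contDiffAt_uncurry hM C (hKM hs)).continuousAt.eventually
      ((hω _ (mem_image_of_mem _ hs)).eventually (by simp))
  filter_upwards [this] with B hB
  rintro _ ⟨s, hs, rfl⟩
  exact hB s hs

/-- The transport theorem in terms of the Lie derivatives: by the group law, `Ω(B)` is the image of
`Ω(C)` under `φ^{B - C}`. -/
theorem hasFDerivAt_integral_move (hφ : IsFlow M V φ) (hM : IsOpen M)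
    (hV : ∀ c, ContDiffOn ℝ (⊤ : ℕ∞) (V c) M) (Ω : OrientedCompactSubmanifold n r)
    (hΩ : Ω.carrier ⊆ M) {ω : DiffForm n r} {C : Fin m → ℝ}
    (hω : ∀ x ∈ φ C '' Ω.carrier, ContDiffAt ℝ 1 ω x) :
    HasFDerivAt (fun B => (hφ.move hM Ω hΩ B).integral ω)
      (dotDC fun c => (hφ.move hM Ω hΩ C).integral (lieDerivative φ c ω)) C := by
  have hCM : (hφ.move hM Ω hΩ C).carrier ⊆ M := by
    rintro _ ⟨s, hs, rfl⟩
    exact hφ.mapsTo C (hΩ hs)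
  have h1 := hφ.hasFDerivAt_integral_pullbackForm hM hV (hφ.move hM Ω hΩ C) hCM hω
  rw [← sub_self C] at h1
  have h2 : HasFDerivAt (fun B => (hφ.move hM Ω hΩ C).integral (pullbackForm (φ (B - C)) ω)) _ C :=
    h1.comp (f := fun B => B - C) C ((hasFDerivAt_id C).sub_const C)
  rw [ContinuousLinearMap.comp_id] at h2
  refine h2.congr_of_eventuallyEq ?_
  filter_upwards [hφ.eventually_contDiffAt hM Ω.isCompact hΩ hω] with B hB
  exact hφ.integral_move hM Ω hΩ B C fun x hx => (hB x hx).continuousAt.continuousWithinAt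

end IsFlow

/-! ### Stokes' theorem -/

theorem halfSpace_succ (r : ℕ) : halfSpace (r + 1) = {u | 0 ≤ u 0} := by
  ext u
  exact ⟨fun h => h (Nat.succ_pos r), fun h _ => h⟩

theorem uniqueDiffOn_halfSpace (r : ℕ) : UniqueDiffOn ℝ (halfSpace r) := by
  refine uniqueDiffOn_convex (fun u hu v hv a b ha hb _ h => ?_)
    ⟨fun _ => 1, mem_interior_iff_mem_nhds.2 ?_⟩
  · simpa using add_nonneg (mul_nonneg ha (hu h)) (mul_nonneg hb (hv h))
  · have : {u : Fin r → ℝ | ∀ i, 0 < u i} ∈ nhds (fun _ : Fin r => (1 : ℝ)) := by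
      refine IsOpen.mem_nhds ?_ fun _ => one_pos
      simp only [ofPred_forall]
      exact isOpen_iInter_of_finite fun i => isOpen_lt continuous_const (continuous_apply i)
    exact Filter.mem_of_superset this fun u hu h => (hu _).le

/-- The divergence theorem on the half-space for compactly supported functions. -/
theorem integral_halfSpace_divergence {r : ℕ} (f : Fin (r + 1) → (Fin (r + 1) → ℝ) → ℝ)
    (hf : ∀ i, ContDiff ℝ 1 (f i)) (hc : ∀ i, HasCompactSupport (f i)) :
    ∫ u in halfSpace (r + 1), ∑ i, fderiv ℝ (f i) u (Pi.single i 1) =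
      -∫ v : Fin r → ℝ, f 0 (Fin.cons 0 v) := by
  obtain ⟨R, hR⟩ : ∃ R : ℝ, ∀ i, tsupport (f i) ⊆ Metric.ball 0 R := by
    have hb : Bornology.IsBounded (⋃ i, tsupport (f i)) :=
      (isCompact_iUnion fun i => hc i).isBounded
    obtain ⟨R, hR⟩ := hb.subset_ball 0
    exact ⟨R, fun i => (subset_iUnion _ i).trans hR⟩
  rcases le_or_gt R 0 with hR0 | hR0
  · have h0 : ∀ i, f i = 0 := fun i => by
      have : tsupport (f i) = ∅ := by
        rw [← subset_empty_iff, ← Metric.ball_eq_empty.2 hR0]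
        exact hR i
      exact tsupport_eq_empty_iff.1 this
    simp [h0]
  have hzero : ∀ i u j, R ≤ |u j| → f i u = 0 := fun i u j hj =>
    image_eq_zero_of_notMem_tsupport fun h => by
      have h1 := mem_ball_zero_iff.1 (hR i h)
      have h2 := norm_le_pi_norm u j
      rw [Real.norm_eq_abs] at h2
      linarith
  have hzero' : ∀ i u j, R ≤ |u j| → fderiv ℝ (f i) u = 0 := fun i u j hj =>
    image_eq_zero_of_notMem_tsupport fun h => by
      have h1 := mem_ball_zero_iff.1 (hR i (tsupport_fderiv_subset ℝ h))
      have h2 := norm_le_pi_norm u j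
      rw [Real.norm_eq_abs] at h2
      linarith
  -- a box in the half-space that has one face on its boundary; `f` vanishes on the other faces
  set a : Fin (r + 1) → ℝ := Fin.cons 0 fun _ => -R with ha
  set b : Fin (r + 1) → ℝ := fun _ => R with hb
  have hab : a ≤ b := fun j => by
    refine Fin.cases ?_ (fun k => ?_) j
    · simpa [ha, hb] using hR0.le
    · simp only [ha, hb, Fin.cons_succ]
      linarith
  have hcont : Continuous fun u => ∑ i, fderiv ℝ (f i) u (Pi.single i 1) :=
    continuous_finsetSum _ fun i _ => ((hf i).continuous_fderiv (by simp)).clm_apply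
      continuous_const
  have key := integral_divergence_of_hasFDerivAt_off_countable' a b hab f
    (fun i u => fderiv ℝ (f i) u) ∅ countable_empty (fun i => (hf i).continuous.continuousOn)
    (fun u _ i => ((hf i).differentiable (by simp) u).hasFDerivAt)
    (hcont.continuousOn.integrableOn_compact isCompact_Icc)
  have hbox : ∫ u in halfSpace (r + 1), ∑ i, fderiv ℝ (f i) u (Pi.single i 1) =
      ∫ u in Icc a b, ∑ i, fderiv ℝ (f i) u (Pi.single i 1) := by
    refine setIntegral_eq_of_subset_of_forall_sdiff_eq_zero (isClosed_halfSpace _).measurableSet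
      ?_ fun u hu => ?_
    · intro u hu
      rw [halfSpace_succ]
      simpa [ha] using hu.1 0
    · have hu0 : 0 ≤ u 0 := by simpa [halfSpace_succ] using hu.1
      obtain ⟨j, hj⟩ : ∃ j, R ≤ |u j| := by
        by_contra! h
        refine hu.2 ⟨fun j => ?_, fun j => (abs_lt.1 (h j)).2.le⟩
        refine Fin.cases ?_ (fun k => ?_) j
        · simpa [ha] using hu0
        · simpa [ha] using (abs_lt.1 (h k.succ)).1.le
      exact Finset.sum_eq_zero fun i _ => by rw [hzero' i u j hj]; rfl
  have hfront : ∀ i : Fin (r + 1), ∀ x : Fin r → ℝ, f i (i.insertNth (b i) x) = 0 := fun i x =>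
    hzero i _ i (by simp [hb, le_abs_self])
  rw [hbox, key, Fin.sum_univ_succ]
  simp only [hfront, integral_zero, zero_sub]
  have hback : ∀ i : Fin r, ∀ x : Fin r → ℝ,
      f i.succ (i.succ.insertNth (a i.succ) x) = 0 := fun i x =>
    hzero _ _ i.succ (by simp [ha, le_abs_self])
  simp only [hback, integral_zero, neg_zero, Finset.sum_const_zero, add_zero]
  congr 1
  rw [setIntegral_eq_integral_of_forall_compl_eq_zero fun v hv => ?_]
  · simp [ha]
  · obtain ⟨j, hj⟩ : ∃ j, R ≤ |v j| := by
      by_contra! h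
      refine hv ⟨fun j => ?_, fun j => ?_⟩
      · simpa [ha] using (abs_lt.1 (h j)).1.le
      · simpa [hb] using (abs_lt.1 (h j)).2.le
    exact hzero _ _ j.succ (by simpa using hj)

section ExtDeriv

variable {n r : ℕ} {η : DiffForm n r} {x : Fin n → ℝ}

set_option maxSynthPendingDepth 3 in
theorem continuousAt_extDeriv (hη : ContDiffAt ℝ 1 η x) : ContinuousAt (extDeriv η) x :=
  (ContinuousAlternatingMap.alternatizeUncurryFinCLM (n := r) ℝ (Fin n → ℝ)
    ℝ).continuous.continuousAt.comp
    (hη.fderiv_right (m := 0) (by norm_num)).continuousAt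

theorem extDeriv_eq_zero_of_eventually_eq_zero (h : ∀ᶠ y in nhds x, η y = 0) :
    extDeriv η x = 0 := by
  rw [Filter.EventuallyEq.extDeriv_eq (ω₂ := fun _ => 0) h]
  ext v
  simp [extDeriv, ContinuousAlternatingMap.alternatizeUncurryFin_apply]

theorem extDeriv_fun_sum {ι : Type*} (s : Finset ι) {η : ι → DiffForm n r}
    (hη : ∀ i ∈ s, DifferentiableAt ℝ (η i) x) :
    extDeriv (fun y => ∑ i ∈ s, η i y) x = ∑ i ∈ s, extDeriv (η i) x := by
  simp only [extDeriv]
  rw [fderiv_fun_sum hη]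
  simp only [← ContinuousAlternatingMap.alternatizeUncurryFinCLM_apply]
  exact map_sum _ _ _

/-- A function whose value is `1` and whose differential vanishes on the given vectors does not
contribute to `d(σ η)`. -/
theorem extDeriv_smul_apply_of_fderiv_eq_zero {σ : (Fin n → ℝ) → ℝ} (hσ : DifferentiableAt ℝ σ x)
    (hη : DifferentiableAt ℝ η x) {w : Fin (r + 1) → Fin n → ℝ} (h1 : σ x = 1)
    (h0 : ∀ i, fderiv ℝ σ x (w i) = 0) :
    extDeriv (fun y => σ y • η y) x w = extDeriv η x w := by
  simp only [extDeriv, ContinuousAlternatingMap.alternatizeUncurryFin_apply]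
  refine Finset.sum_congr rfl fun i _ => ?_
  rw [fderiv_fun_smul hσ hη]
  simp [h1, h0]

end ExtDeriv

namespace OrientedCompactSubmanifold

variable {n r : ℕ} {p : SignedPatch n r} {η : DiffForm n r}

theorem integral_congr_density {Ω : OrientedCompactSubmanifold n r} {η θ : DiffForm n r}
    (h : ∀ q ∈ Ω.charts, ∀ u ∈ q.source, q.density η u = q.density θ u) :
    Ω.integral η = Ω.integral θ := by
  simp only [integral_eq_sum, SignedPatch.integral]
  refine Finset.sum_congr rfl fun i _ => congrArg _ ?_
  refine setIntegral_congr_fun (SignedPatch.measurableSet_source _) fun u hu => ?_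
  simp only [SignedPatch.density_smul, h _ (Ω.partition.chart_mem i) u hu]

/-- Stokes' theorem for a form that is localized in a chart: a cutoff function extends its pullback
to a compactly supported form on `ℝʳ⁺¹`, to which the divergence theorem on the half-space
applies. -/
theorem integral_patch_extDeriv {Ω : OrientedCompactSubmanifold n (r + 1)}
    {p : SignedPatch n (r + 1)} (hp : p ∈ Ω.charts)
    (hη : ∀ x ∈ Ω.carrier, ContDiffAt ℝ 1 η x) {ρ : (Fin n → ℝ) → ℝ}
    (hρ : ContDiff ℝ (⊤ : ℕ∞) ρ) (hρp : Ω.carrier ∩ tsupport ρ ⊆ p.target) :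
    p.integral (extDeriv fun x => ρ x • η x) =
      -((p.sign : ℤ) : ℝ) * patchIntegral {v : Fin r → ℝ | (Fin.cons 0 v : Fin (r + 1) → ℝ) ∈ p.dom}
        (fun v => p.param (Fin.cons 0 v)) ρ η := by
  set θ : DiffForm n r := fun x => ρ x • η x with hθ
  have hθs : ∀ x, ContDiffAt ℝ 1 η x → ContDiffAt ℝ 1 θ x := fun x hx =>
    (hρ.contDiffAt.of_le (by norm_cast)).smul hx
  set K : Set (Fin (r + 1) → ℝ) := p.source ∩ p.param ⁻¹' (Ω.carrier ∩ tsupport ρ) with hK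
  have hKc : IsCompact K :=
    isCompact_source_inter_preimage hp (isCompact_carrier_inter_tsupport ρ) hρp
  set O : Set (Fin (r + 1) → ℝ) := {u | u ∈ p.dom ∧ ContDiffAt ℝ 1 η (p.param u)} with hO
  have hOo : IsOpen O := by
    rw [isOpen_iff_mem_nhds]
    intro u hu
    exact Filter.inter_mem (p.isOpen_dom.mem_nhds hu.1)
      ((p.differentiableAt hu.1).continuousAt.eventually (hu.2.eventually (by simp)))
  have hKO : K ⊆ O := fun u hu => ⟨hu.1.1, hη _ hu.2.1⟩
  obtain ⟨t, htc, hKt, htO⟩ := exists_compact_between hKc hOo hKO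
  obtain ⟨χ, hχ1, hχ0, -⟩ := exists_contMDiffMap_one_nhds_of_subset_interior
    (n := (⊤ : ℕ∞)) (modelWithCornersSelf ℝ (Fin (r + 1) → ℝ)) hKc.isClosed hKt
  have hχs : ContDiff ℝ 1 χ := χ.contMDiff.contDiff.of_le (by norm_cast)
  have hχK : ∀ u ∈ K, ∀ᶠ w in nhds u, χ w = 1 := fun u hu =>
    hχ1.filter_mono (nhds_le_nhdsSet hu)
  have hχt : ∀ u, u ∉ t → ∀ᶠ w in nhds u, χ w = 0 := fun u hu => by
    filter_upwards [htc.isClosed.isOpen_compl.mem_nhds hu] with w hw using hχ0 w hw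
  -- off the compact set `K`, the form vanishes near the points of the chart
  have hoff : ∀ u ∈ p.source, u ∉ K → ∀ᶠ x in nhds (p.param u), θ x = 0 := by
    intro u hu huK
    have : p.param u ∉ tsupport ρ := fun h => huK ⟨hu, param_mem hp hu, h⟩
    filter_upwards [(isClosed_tsupport ρ).isOpen_compl.mem_nhds this] with x hx
    simp only [hθ, image_eq_zero_of_notMem_tsupport hx, zero_smul]
  set e : Fin (r + 1) → Fin (r + 1) → ℝ := fun i => Pi.single i 1 with he
  set g : Fin (r + 1) → (Fin (r + 1) → ℝ) → ℝ := fun i u =>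
    θ (p.param u) (fun j => fderiv ℝ p.param u (i.removeNth e j)) with hg
  -- with this vector field, the divergence is the coefficient of the exterior derivative
  set f : Fin (r + 1) → (Fin (r + 1) → ℝ) → ℝ := fun i u => (-1) ^ (i : ℕ) * (χ u * g i u) with hf
  have hgs : ∀ i, ∀ u ∈ O, ContDiffAt ℝ 1 (g i) u := by
    intro i u hu
    have h1 : ContDiffAt ℝ 1 (fun u => θ (p.param u)) u :=
      (hθs _ hu.2).comp u ((p.contDiffAt hu.1).of_le (by norm_cast))
    have h2 : ContDiffAt ℝ 1 (fun u => fun j => fderiv ℝ p.param u (i.removeNth e j)) u :=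
      contDiffAt_pi.2 fun j => ((p.contDiffAt hu.1).fderiv_right (m := 1) (by norm_cast)).clm_apply
        contDiffAt_const
    exact contDiff_continuousAlternatingMap_apply.contDiffAt.comp u (h1.prodMk h2)
  have hf0 : ∀ i u, u ∉ t → ∀ᶠ w in nhds u, f i w = 0 := fun i u hu => by
    filter_upwards [hχt u hu] with w hw
    simp [hf, hw]
  have hfs : ∀ i, ContDiff ℝ 1 (f i) := by
    intro i
    rw [contDiff_iff_contDiffAt]
    intro u
    by_cases hu : u ∈ t
    · exact contDiffAt_const.mul (hχs.contDiffAt.mul (hgs i u (htO hu)))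
    · exact contDiffAt_const.congr_of_eventuallyEq (hf0 i u hu)
  have hfc : ∀ i, HasCompactSupport (f i) := fun i =>
    HasCompactSupport.intro htc fun u hu => (hf0 i u hu).self_of_nhds
  have key := integral_halfSpace_divergence f hfs hfc
  have hleft : ∫ u in halfSpace (r + 1), ∑ i, fderiv ℝ (f i) u (Pi.single i 1) =
      ∫ u in p.source, p.density (extDeriv θ) u := by
    rw [setIntegral_eq_of_subset_of_forall_sdiff_eq_zero
      (isClosed_halfSpace _).measurableSet (inter_subset_right : p.source ⊆ _)]
    · refine setIntegral_congr_fun p.measurableSet_source fun u hu => ?_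
      by_cases huK : u ∈ K
      · have huO := hKO huK
        have hθd : DifferentiableAt ℝ θ (p.param u) := (hθs _ huO.2).differentiableAt one_ne_zero
        have hψ2 : DifferentiableAt ℝ (fderiv ℝ p.param) u :=
          ((p.contDiffAt huO.1).fderiv_right (m := 1) (by norm_cast)).differentiableAt one_ne_zero
        have hβ : DifferentiableAt ℝ
            (fun u => (θ (p.param u)).compContinuousLinearMap (fderiv ℝ p.param u)) u :=
          (hθd.comp u (p.differentiableAt huO.1)).continuousAlternatingMapCompContinuousLinearMap
            hψ2
        have h1 := congrArg (fun T => T e) (extDeriv_pullback hθd (p.contDiffAt huO.1) (by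
          rw [minSmoothness_of_isRCLikeNormedField]
          exact WithTop.coe_le_coe.2 le_top))
        simp only [extDeriv_apply hβ] at h1
        refine Eq.trans (Finset.sum_congr rfl fun i _ => ?_) h1
        have h2 : f i =ᶠ[nhds u] fun w => (-1) ^ (i : ℕ) * g i w := by
          filter_upwards [hχK u huK] with w hw
          simp [hf, hw]
        rw [h2.fderiv_eq, fderiv_const_mul ((hgs i u huO).differentiableAt one_ne_zero)]
        simp [hg, he, Function.comp_def]
      · have h1 := hoff u hu huK
        have h2 : extDeriv θ (p.param u) = 0 := extDeriv_eq_zero_of_eventually_eq_zero h1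
        have h3 : ∀ i, fderiv ℝ (f i) u = 0 := fun i => by
          have : f i =ᶠ[nhds u] fun _ => 0 := by
            filter_upwards [(p.differentiableAt hu.1).continuousAt.eventually h1] with w hw
            simp [hf, hg, hw]
          rw [this.fderiv_eq]
          simp
        simp [SignedPatch.density, h2, h3]
    · intro u hu
      have hut : u ∉ t := fun h => hu.2 ⟨(htO h).1, hu.1⟩
      refine Finset.sum_eq_zero fun i _ => ?_
      rw [Filter.EventuallyEq.fderiv_eq (f := fun _ => 0) (hf0 i u hut)]
      simp
  have hcons : Continuous fun v : Fin r → ℝ => (Fin.cons 0 v : Fin (r + 1) → ℝ) :=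
    continuous_const.finCons continuous_id
  have hright : ∫ v : Fin r → ℝ, f 0 (Fin.cons 0 v) =
      patchIntegral {v : Fin r → ℝ | (Fin.cons 0 v : Fin (r + 1) → ℝ) ∈ p.dom}
        (fun v => p.param (Fin.cons 0 v)) ρ η := by
    rw [patchIntegral, ← setIntegral_eq_integral_of_forall_compl_eq_zero
      (s := {v : Fin r → ℝ | (Fin.cons 0 v : Fin (r + 1) → ℝ) ∈ p.dom})]
    · refine setIntegral_congr_fun (p.isOpen_dom.preimage hcons).measurableSet fun v hv => ?_
      set u : Fin (r + 1) → ℝ := Fin.cons 0 v with hu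
      have hus : u ∈ p.source := ⟨hv, by simp [halfSpace_succ, hu]⟩
      have hfg : f 0 u = g 0 u := by
        by_cases huK : u ∈ K
        · simp [hf, (hχK u huK).self_of_nhds]
        · simp [hf, hg, (hoff u hus huK).self_of_nhds]
      have hd : ∀ j : Fin r, fderiv ℝ (fun v : Fin r → ℝ => p.param (Fin.cons 0 v)) v
          (Pi.single j 1) = fderiv ℝ p.param u (Pi.single j.succ 1) := by
        intro j
        set L : (Fin r → ℝ) →L[ℝ] (Fin (r + 1) → ℝ) := ContinuousLinearMap.pi
          (Fin.cons 0 fun j => ContinuousLinearMap.proj j) with hL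
        have hLv : ∀ w, L w = Fin.cons 0 w := fun w => by
          ext1 k
          refine Fin.cases ?_ (fun k => ?_) k <;> simp [hL]
        have h1 : HasFDerivAt (fun v : Fin r → ℝ => p.param (Fin.cons 0 v))
            ((fderiv ℝ p.param u).comp L) v := by
          have h2 : HasFDerivAt (fun v : Fin r → ℝ => (Fin.cons 0 v : Fin (r + 1) → ℝ)) L v := by
            rw [← funext hLv]
            exact L.hasFDerivAt
          exact (p.differentiableAt hv).hasFDerivAt.comp v h2
        rw [h1.fderiv, ContinuousLinearMap.comp_apply, hLv]
        congr 1
        ext1 k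
        refine Fin.cases ?_ (fun k => ?_) k <;> simp [Pi.single_apply]
      simp only [hd]
      rw [hfg]
      simp [hg, hθ, he, Fin.removeNth, hu]
    · intro v hv
      exact (hf0 0 _ fun h => hv (htO h).1).self_of_nhds
  rw [SignedPatch.integral, ← hleft, key, hright]
  ring

/-- The sum of the weights of a partition of unity is constant along the submanifold, so its
differential vanishes on tangent vectors. -/
theorem fderiv_sum_weight {Ω : OrientedCompactSubmanifold n r} (P : ChartPartition Ω)
    {q : SignedPatch n r} (hq : q ∈ Ω.charts) {u : Fin r → ℝ} (hu : u ∈ q.source)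
    (w : Fin r → ℝ) :
    fderiv ℝ (fun x => ∑ i, P.weight i x) (q.param u) (fderiv ℝ q.param u w) = 0 := by
  have hσ : DifferentiableAt ℝ (fun x => ∑ i, P.weight i x) (q.param u) :=
    DifferentiableAt.fun_sum fun i _ => (P.smooth i).contDiffAt.differentiableAt (by simp)
  have h1 := (hσ.hasFDerivAt.comp u (q.differentiableAt hu.1).hasFDerivAt).hasFDerivWithinAt
    (s := q.source)
  have h2 : HasFDerivWithinAt ((fun x => ∑ i, P.weight i x) ∘ q.param)
      (0 : (Fin r → ℝ) →L[ℝ] ℝ) q.source u :=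
    (hasFDerivWithinAt_const (1 : ℝ) u q.source).congr
      (fun v hv => P.sum_eq_one _ (param_mem hq hv)) (P.sum_eq_one _ (param_mem hq hu))
  have hud : UniqueDiffWithinAt ℝ q.source u := by
    have := (uniqueDiffOn_halfSpace r u hu.2).inter (q.isOpen_dom.mem_nhds hu.1)
    rwa [inter_comm] at this
  exact congrArg (fun L => L w) (hud.eq h1 h2)

/-- Stokes' theorem. The forms `d(ρᵢ η)`, for the weights `ρᵢ` of the partition, live in single
charts; their sum has the same restriction to the submanifold as `dη`. -/
theorem integral_extDeriv (Ω : OrientedCompactSubmanifold n (r + 1))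
    (hη : ∀ x ∈ Ω.carrier, ContDiffAt ℝ 1 η x) :
    Ω.integral (extDeriv η) = Ω.boundaryIntegral η := by
  set P := Ω.partition with hP
  set θ : Fin P.size → DiffForm n r := fun i x => P.weight i x • η x with hθ
  have hθs : ∀ i, ∀ x ∈ Ω.carrier, ContDiffAt ℝ 1 (θ i) x := fun i x hx =>
    ((P.smooth i).contDiffAt.of_le (by norm_cast)).smul (hη x hx)
  have hθc : ∀ i, ContinuousOn (extDeriv (θ i)) Ω.carrier := fun i x hx =>
    (continuousAt_extDeriv (hθs i x hx)).continuousWithinAt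
  have hpatch : ∀ i, Ω.integral (extDeriv (θ i)) = (P.chart i).integral (extDeriv (θ i)) := by
    intro i
    refine integral_eq_integral_patch (P.chart_mem i) (hθc i)
      (isCompact_carrier_inter_tsupport (P.weight i)) (P.support i) fun x hx hxK => ?_
    refine extDeriv_eq_zero_of_eventually_eq_zero ?_
    filter_upwards [(isClosed_tsupport (P.weight i)).isOpen_compl.mem_nhds
      fun h => hxK ⟨hx, h⟩] with y hy
    simp only [hθ, image_eq_zero_of_notMem_tsupport hy, zero_smul]
  have hbdry : Ω.boundaryIntegral η = ∑ i, Ω.integral (extDeriv (θ i)) :=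
    Finset.sum_congr rfl fun i _ => by
      rw [hpatch i]
      exact (integral_patch_extDeriv (P.chart_mem i) hη (P.smooth i) (P.support i)).symm
  rw [hbdry, ← Ω.integral_sum _ fun i _ => hθc i]
  have hsum : Ω.integral (fun x => ∑ i, extDeriv (θ i) x) =
      Ω.integral (extDeriv fun x => (∑ i, P.weight i x) • η x) := by
    refine integral_congr fun x hx => ?_
    simp only [Finset.sum_smul]
    exact (extDeriv_fun_sum _ fun i _ => (hθs i x hx).differentiableAt one_ne_zero).symm
  rw [hsum]
  refine integral_congr_density fun q hq u hu => ?_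
  refine (extDeriv_smul_apply_of_fderiv_eq_zero ?_
    ((hη _ (param_mem hq hu)).differentiableAt one_ne_zero) (P.sum_eq_one _ (param_mem hq hu))
    fun i => fderiv_sum_weight P hq hu _).symm
  exact DifferentiableAt.fun_sum fun i _ => (P.smooth i).contDiffAt.differentiableAt (by simp)

end OrientedCompactSubmanifold

/-! ### Cartan's formula and Stokes' theorem for the transported integral -/

theorem contDiffAt_interiorProduct {n r : ℕ} {X : (Fin n → ℝ) → (Fin n → ℝ)} {ω : DiffForm n r}
    {x : Fin n → ℝ} (hX : ContDiffAt ℝ 1 X x) (hω : ContDiffAt ℝ 1 ω x) :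
    ContDiffAt ℝ 1 (interiorProduct X ω) x := by
  cases r with
  | zero => exact contDiffAt_const
  | succ r => exact contDiffAt_curryLeft hX hω

theorem continuousAt_interiorProductExtDeriv {n r : ℕ} {X : (Fin n → ℝ) → (Fin n → ℝ)}
    {ω : DiffForm n r} {x : Fin n → ℝ} (hX : ContDiffAt ℝ 1 X x) (hω : ContDiffAt ℝ 1 ω x) :
    ContinuousAt (interiorProductExtDeriv X ω) x :=
  continuousAt_curryLeft hX.continuousAt (continuousAt_extDeriv hω)

theorem continuousAt_extDerivInteriorProduct {n r : ℕ} {X : (Fin n → ℝ) → (Fin n → ℝ)}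
    {ω : DiffForm n r} {x : Fin n → ℝ} (hX : ContDiffAt ℝ 1 X x) (hω : ContDiffAt ℝ 1 ω x) :
    ContinuousAt (extDerivInteriorProduct X ω) x := by
  cases r with
  | zero => exact continuousAt_const
  | succ r => exact continuousAt_extDeriv (contDiffAt_interiorProduct hX hω)

/-- Stokes' theorem for `i_X ω`, in all degrees. -/
theorem OrientedCompactSubmanifold.integral_extDerivInteriorProduct {n r : ℕ}
    (Ω : OrientedCompactSubmanifold n r) {X : (Fin n → ℝ) → (Fin n → ℝ)} {ω : DiffForm n r}
    (hX : ∀ x ∈ Ω.carrier, ContDiffAt ℝ 1 X x) (hω : ∀ x ∈ Ω.carrier, ContDiffAt ℝ 1 ω x) :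
    Ω.integral (extDerivInteriorProduct X ω) = Ω.boundaryIntegral (interiorProduct X ω) := by
  cases r with
  | zero =>
    simp [OrientedCompactSubmanifold.integral, OrientedCompactSubmanifold.boundaryIntegral,
      extDerivInteriorProduct, patchIntegral]
  | succ r =>
    exact Ω.integral_extDeriv fun x hx => contDiffAt_interiorProduct (hX x hx) (hω x hx)

theorem theorem1 {n m r : ℕ} (M : Set (Fin n → ℝ)) (hM : IsOpen M)
    (V : Fin m → (Fin n → ℝ) → (Fin n → ℝ)) (hV : ∀ c, ContDiffOn ℝ (⊤ : ℕ∞) (V c) M)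
    (φ : (Fin m → ℝ) → (Fin n → ℝ) → (Fin n → ℝ)) (hφ : IsFlow M V φ)
    (Ω : OrientedCompactSubmanifold n r) (hΩ : Ω.carrier ⊆ M)
    (ω : DiffForm n r) (C : Fin m → ℝ)
    (hω : ∀ x ∈ φ C '' Ω.carrier, ContDiffAt ℝ 1 ω x) :
    -- the limits that define the Lie derivatives exist, and Cartan's formula holds
    (∀ c, ∀ x ∈ φ C '' Ω.carrier,
      HasDerivAt (fun h : ℝ => pullbackForm (φ (h • (Pi.single c 1 : Fin m → ℝ))) ω x)
        (lieDerivative φ c ω x) 0 ∧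
      lieDerivative φ c ω x =
        interiorProductExtDeriv (V c) ω x + extDerivInteriorProduct (V c) ω x) ∧
    -- the total differential of the integral, in three forms
    HasFDerivAt (fun B => (hφ.move hM Ω hΩ B).integral ω)
      (dotDC fun c => (hφ.move hM Ω hΩ C).integral (lieDerivative φ c ω)) C ∧
    HasFDerivAt (fun B => (hφ.move hM Ω hΩ B).integral ω)
      (dotDC fun c =>
        (hφ.move hM Ω hΩ C).integral (interiorProductExtDeriv (V c) ω) +
        (hφ.move hM Ω hΩ C).boundaryIntegral (interiorProduct (V c) ω)) C ∧
    HasFDerivAt (fun B => (hφ.move hM Ω hΩ B).integral ω)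
      (dotDC fun c =>
        (hφ.move hM Ω hΩ C).integral
          (fun x => interiorProductExtDeriv (V c) ω x +
            extDerivInteriorProduct (V c) ω x)) C := by
  have hCM : ∀ x ∈ φ C '' Ω.carrier, x ∈ M := by
    rintro _ ⟨s, hs, rfl⟩
    exact hφ.mapsTo C (hΩ hs)
  have hVs : ∀ c, ∀ x ∈ φ C '' Ω.carrier, ContDiffAt ℝ 1 (V c) x := fun c x hx =>
    ((hV c).contDiffAt (hM.mem_nhds (hCM x hx))).of_le (by norm_cast)
  have hlie : ∀ c, ∀ x ∈ φ C '' Ω.carrier,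
      HasDerivAt (fun h : ℝ => pullbackForm (φ (h • (Pi.single c 1 : Fin m → ℝ))) ω x)
        (interiorProductExtDeriv (V c) ω x + extDerivInteriorProduct (V c) ω x) 0 := fun c x hx =>
    hφ.hasDerivAt_pullbackForm hM hV (hCM x hx) c ((hω x hx).differentiableAt one_ne_zero)
  have hcartan : ∀ c, (hφ.move hM Ω hΩ C).integral (lieDerivative φ c ω) =
      (hφ.move hM Ω hΩ C).integral
        (fun x => interiorProductExtDeriv (V c) ω x + extDerivInteriorProduct (V c) ω x) :=
    fun c => OrientedCompactSubmanifold.integral_congr fun x hx => (hlie c x hx).deriv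
  have hstokes : ∀ c, (hφ.move hM Ω hΩ C).integral (lieDerivative φ c ω) =
      (hφ.move hM Ω hΩ C).integral (interiorProductExtDeriv (V c) ω) +
        (hφ.move hM Ω hΩ C).boundaryIntegral (interiorProduct (V c) ω) := fun c => by
    rw [hcartan c, OrientedCompactSubmanifold.integral_add,
      OrientedCompactSubmanifold.integral_extDerivInteriorProduct _ (hVs c) hω]
    · exact fun x hx =>
        (continuousAt_interiorProductExtDeriv (hVs c x hx) (hω x hx)).continuousWithinAt
    · exact fun x hx =>
        (continuousAt_extDerivInteriorProduct (hVs c x hx) (hω x hx)).continuousWithinAt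
  have hmain := hφ.hasFDerivAt_integral_move hM hV Ω hΩ hω
  refine ⟨fun c x hx => ?_, hmain, ?_, ?_⟩
  · have h1 : lieDerivative φ c ω x =
        interiorProductExtDeriv (V c) ω x + extDerivInteriorProduct (V c) ω x :=
      (hlie c x hx).deriv
    exact ⟨h1 ▸ hlie c x hx, h1⟩
  · simpa only [hstokes] using hmain
  · simpa only [hcartan] using hmain
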